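/- Let $A_c>0$ and $\sqrt{A_c}\le d\le A_c$ (lengths are measured in carrier wavelengths). Consider the two squares of area $A_c$ at distance $d$, $D_T=[-\sqrt{A_c},0]\times[0,\sqrt{A_c}]$ and $D_R=[d,d+\sqrt{A_c}]\times[0,\sqrt{A_c}]$. Let $M$ transmitters $\boldsymbol x_1,\dots,\boldsymbol x_M$ and $M$ receivers $\boldsymbol w_1,\dots,\boldsymbol w_M$ be independent, the $\boldsymbol x_k$ uniformly distributed on $D_T$ and the $\boldsymbol w_i$ on $D_R$. Let $r_{ik}=\|\boldsymbol x_k-\boldsymbol w_i\|$ and let $H$ be the $M\times M$ line-of-sight channel matrix $H_{ik}=\sqrt G\,e^{2\pi j r_{ik}}/r_{ik}$ with $G>0$. Let $N_0,W>0$ (noise level and bandwidth) and let the total transmit power $P_0$ satisfy $\frac{GP_0}{N_0Wd^2}>1$ (that is, $>0$ dB). Then there is a constant $K_3>0$, independent of $M,A_c,d,G,P_0,N_0,W$, such that $$\mathbb E\,\log\det\Big(I+\frac{P_0}{N_0W}\,\frac1M\,HH^\dagger\Big)\;\ge\;K_3\,\min\Big(M,\ \frac{A_c/d}{\max(1,\log(A_c/d))}\Big),$$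 where the expectation over the node positions exists. In particular, if $d\le A_c/e$, the bound is $K_3\min\big(M,\frac{A_c/d}{\log(A_c/d)}\big)$. Moreover, put $f(\boldsymbol x,\boldsymbol w)=\frac{d}{\|\boldsymbol x-\boldsymbol w\|}e^{2\pi j\|\boldsymbol x-\boldsymbol w\|}$ and let $\boldsymbol x_a,\boldsymbol x_b$ be uniform on $D_T$ and $\boldsymbol w_a,\boldsymbol w_b$ uniform on $D_R$, all independent. Then there is a constant $K>0$, independent of $A_c$ and $d$, such that $$S:=\Big|\mathbb E\big(f(\boldsymbol x_a,\boldsymbol w_a)\,\overline{f(\boldsymbol x_a,\boldsymbol w_b)}\,f(\boldsymbol x_b,\boldsymbol w_b)\,\overline{f(\boldsymbol x_b,\boldsymbol w_a)}\big)\Big|\;\le\;K\,\frac{d}{A_c}\,\max\big(1,\log(A_c/d)\big)$$ for all $A_c>0$ and $\sqrt{A_c}\le d\le A_c$. -/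

import Mathlib

open MeasureTheory

noncomputable section

/-- The Euclidean plane; lengths are measured in wavelengths. -/
abbrev Plane : Type := EuclideanSpace ℝ (Fin 2)

/-- The transmit cluster: the square `[-√A, 0] × [0, √A]` of area `A`. -/
def transmitSquare (A : ℝ) : Set Plane :=
  {p | p 0 ∈ Set.Icc (-√A) 0 ∧ p 1 ∈ Set.Icc 0 (√A)}

/-- The receive cluster: the square `[d, d + √A] × [0, √A]` of area `A`, facing the transmit
cluster at distance `d`. -/
def receiveSquare (A d : ℝ) : Set Plane :=
  {p | p 0 ∈ Set.Icc d (d + √A) ∧ p 1 ∈ Set.Icc 0 (√A)}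

/-- The uniform distribution on a planar region: normalized Lebesgue measure. -/
def uniformOn (D : Set Plane) : Measure Plane :=
  ProbabilityTheory.cond volume D

/-- The joint law of the node positions: the positions `x k` of the `M` transmitters and `w i` of
the `M` receivers are all independent and uniform on their clusters. -/
def nodeLaw (M : ℕ) (A d : ℝ) : Measure ((Fin M → Plane) × (Fin M → Plane)) :=
  (Measure.pi fun _ : Fin M => uniformOn (transmitSquare A)).prod
    (Measure.pi fun _ : Fin M => uniformOn (receiveSquare A d))

/-- The line-of-sight channel matrix `H i k = √G * exp(2πj r i k) / r i k`, where `r i k` is the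
distance from the transmitter at `x k` to the receiver at `w i`. -/
def channel {M : ℕ} (G : ℝ) (x w : Fin M → Plane) : Matrix (Fin M) (Fin M) ℂ :=
  Matrix.of fun i k =>
    (√G : ℂ) * (Complex.exp (2 * Real.pi * Complex.I * (dist (x k) (w i) : ℝ)) /
      (dist (x k) (w i) : ℝ))

/-- The capacity `log det (I + (s / M) H H†)`, in nats, for total power to noise ratio `s`.
The determinant is that of a positive definite Hermitian matrix, hence a positive real number. -/
def mimoCapacity {M : ℕ} (s : ℝ) (H : Matrix (Fin M) (Fin M) ℂ) : ℝ :=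
  Real.log (Matrix.det (1 + ((s / M : ℝ) : ℂ) • (H * H.conjTranspose))).re

/-- The normalized channel gain `(d / r) * exp(2πj r)` between a transmitter at `x` and a receiver
at `w`, where `r` is their distance. -/
def normalizedGain (d : ℝ) (x w : Plane) : ℂ :=
  ((d / dist x w : ℝ) : ℂ) * Complex.exp (2 * Real.pi * Complex.I * (dist x w : ℝ))

/-- The product `f_aa * conj f_ba * f_bb * conj f_ab` for transmitters at `q.1 = (x_a, x_b)` and
receivers at `q.2 = (w_a, w_b)`, where `f_ik` is the normalized gain from `x_k` to `w_i`. -/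
def gainCycle (d : ℝ) (q : (Plane × Plane) × (Plane × Plane)) : ℂ :=
  normalizedGain d q.1.1 q.2.1 * starRingEnd ℂ (normalizedGain d q.1.1 q.2.2) *
    normalizedGain d q.1.2 q.2.2 * starRingEnd ℂ (normalizedGain d q.1.2 q.2.1)

/-- The joint law of two transmitters and two receivers, independent and uniform on their
clusters. -/
def fourNodeLaw (A d : ℝ) : Measure ((Plane × Plane) × (Plane × Plane)) :=
  ((uniformOn (transmitSquare A)).prod (uniformOn (transmitSquare A))).prod
    ((uniformOn (receiveSquare A d)).prod (uniformOn (receiveSquare A d)))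

end

/-! Two moments of the spectrum control the capacity. For eigenvalues `y ≥ 0` of `(s/M) H H†` and `0
≤ ε ≤ 1` one has `log (1 + y) ≥ ε y - ε² y²`, so the expected capacity is at least `ε E tr - ε² E
tr²`. All distances lie between `d` and `√10 d`, hence `E tr` is of order `s M`. In `E tr²` the
quadruples with a repeated transmitter or receiver contribute at most `2 s² M`, and each remaining
one contributes at most `S`, for a total of at most `s² M² S`. With `S ≤ 200 d / A` and `ε` of order
`1 / (s (1 + M d / A))` the bound has order `min M (A / d)`.

To bound `S`, condition on the transmitters: `S` is the mean of `|E_w f(x_a, w) conj f(x_b, w)|²`.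
By Jensen it is enough to average over the height of `w` before squaring, which leaves an
oscillatory integral with phase `2π (r_a - r_b)` along a vertical segment. The phase derivative is
comparable to an affine function of the height, `cross`, divided by `r_a r_b`, so integration by
parts applies away from the zero of `cross`, and a smoothed cutoff handles a neighbourhood of it.
This gives `norm_integral_fringe_le_of_far` and `norm_integral_fringe_le_of_ne`.

Squaring and integrating over the height of `x_a` (`lintegral_average_fringe_le`), the near bound is
inversely proportional to `|qb - qa|`, while the interval of heights where it is needed has length
proportional to `|qb - qa|`. The two cancel, so no logarithm arises, and the logarithmic bounds
claimed follow since `max 1 (log (A / d)) ≥ 1`. -/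

noncomputable section

/-! ### Integration by parts for oscillatory integrals. -/

open scoped ENNReal ComplexOrder

/-- Integration by parts: `φ' exp(iφ)` is the derivative of `-i exp(iφ)`, and the exponential has
modulus one. -/
theorem norm_integral_deriv_mul_exp_le {a b : ℝ} (hab : a ≤ b) {φ φ' w w' : ℝ → ℝ}
    (hφ : ∀ t ∈ Set.Icc a b, HasDerivAt φ (φ' t) t)
    (hw : ∀ t ∈ Set.Icc a b, HasDerivAt w (w' t) t)
    (hφ' : ContinuousOn φ' (Set.Icc a b)) (hw' : ContinuousOn w' (Set.Icc a b)) :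
    ‖∫ t in a..b, ((φ' t * w t : ℝ) : ℂ) * Complex.exp (φ t * Complex.I)‖ ≤
      |w a| + |w b| + ∫ t in a..b, |w' t| := by
  have hφc : ContinuousOn φ (Set.Icc a b) := fun t ht => (hφ t ht).continuousAt.continuousWithinAt
  have hwc : ContinuousOn w (Set.Icc a b) := fun t ht => (hw t ht).continuousAt.continuousWithinAt
  have hexp : ContinuousOn (fun t => Complex.exp (φ t * Complex.I)) (Set.Icc a b) := by
    fun_prop
  have hc1 : ContinuousOn (fun t => ((φ' t * w t : ℝ) : ℂ) * Complex.exp (φ t * Complex.I))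
      (Set.Icc a b) := by
    refine ContinuousOn.mul ?_ hexp
    exact Complex.continuous_ofReal.comp_continuousOn (hφ'.mul hwc)
  have hc2 : ContinuousOn (fun t => (w' t : ℂ) * Complex.exp (φ t * Complex.I))
      (Set.Icc a b) :=
    (Complex.continuous_ofReal.comp_continuousOn hw').mul hexp
  have hi1 := hc1.intervalIntegrable_of_Icc (μ := volume) hab
  have hi2 := hc2.intervalIntegrable_of_Icc (μ := volume) hab
  have hder : ∀ t ∈ Set.uIcc a b,
      HasDerivAt (fun t => -Complex.I * ((w t : ℂ) * Complex.exp (φ t * Complex.I)))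
        (((φ' t * w t : ℝ) : ℂ) * Complex.exp (φ t * Complex.I) -
          Complex.I * ((w' t : ℂ) * Complex.exp (φ t * Complex.I))) t := by
    intro t ht
    rw [Set.uIcc_of_le hab] at ht
    have h1 := (hφ t ht).ofReal_comp
    have h2 := (hw t ht).ofReal_comp
    have h3 := ((h2.mul (h1.mul_const Complex.I).cexp).const_mul (-Complex.I))
    refine h3.congr_deriv ?_
    push_cast
    linear_combination (-(φ' t : ℂ) * w t * Complex.exp (φ t * Complex.I)) * Complex.I_sq
  have hftc := intervalIntegral.integral_eq_sub_of_hasDerivAt hder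
    (hi1.sub (hi2.const_mul Complex.I))
  rw [intervalIntegral.integral_sub hi1 (hi2.const_mul _), intervalIntegral.integral_const_mul] at hftc
  have hnorm : ∀ (c s : ℝ), ‖(c : ℂ) * Complex.exp (s * Complex.I)‖ = |c| := by
    intro c s
    rw [norm_mul, Complex.norm_exp_ofReal_mul_I, mul_one, Complex.norm_real, Real.norm_eq_abs]
  have hlast : ‖∫ t in a..b, (w' t : ℂ) * Complex.exp (φ t * Complex.I)‖ ≤
      ∫ t in a..b, |w' t| := by
    refine (intervalIntegral.norm_integral_le_integral_norm hab).trans (le_of_eq ?_)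
    simp only [hnorm]
  rw [sub_eq_iff_eq_add] at hftc
  rw [hftc]
  refine (norm_add_le _ _).trans ?_
  refine add_le_add ((norm_sub_le _ _).trans ?_) ?_
  · simp only [norm_mul, norm_neg, Complex.norm_I, one_mul]
    rw [← norm_mul, ← norm_mul, hnorm, hnorm, add_comm]
  · rw [norm_mul, Complex.norm_I, one_mul]; exact hlast

/-! ### Geometry of the phase `r_a - r_b` along a vertical line. -/

/-- Length of the hypotenuse with legs `q` and `t - v`. -/
def hypot (q v t : ℝ) : ℝ := √(q ^ 2 + (t - v) ^ 2)

theorem hypot_sq (q v t : ℝ) : hypot q v t ^ 2 = q ^ 2 + (t - v) ^ 2 :=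
  Real.sq_sqrt (by positivity)

theorem le_hypot (q v t : ℝ) : q ≤ hypot q v t :=
  Real.le_sqrt_of_sq_le (by nlinarith [sq_nonneg (t - v)])

theorem abs_sub_le_hypot (q v t : ℝ) : |t - v| ≤ hypot q v t :=
  Real.abs_le_sqrt (by nlinarith [sq_nonneg q])

theorem hypot_pos {q : ℝ} (hq : 0 < q) (v t : ℝ) : 0 < hypot q v t := hq.trans_le (le_hypot q v t)

theorem hypot_le {q v t : ℝ} (hq : 0 < q) (h : |t - v| ≤ q) : hypot q v t ≤ 3 / 2 * q := by
  refine Real.sqrt_le_iff.2 ⟨by positivity, ?_⟩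
  nlinarith [sq_abs (t - v), abs_nonneg (t - v)]

theorem hasDerivAt_hypot {q : ℝ} (hq : 0 < q) (v t : ℝ) :
    HasDerivAt (hypot q v) ((t - v) / hypot q v t) t := by
  have h1 : HasDerivAt (fun t => q ^ 2 + (t - v) ^ 2) (2 * (t - v)) t := by
    have := (((hasDerivAt_id t).sub_const v).pow 2).const_add (q ^ 2)
    simpa using this
  have h2 := h1.sqrt (by positivity)
  refine h2.congr_deriv ?_
  rw [mul_div_mul_left _ _ two_ne_zero, hypot]

theorem continuous_hypot (q v : ℝ) : Continuous (hypot q v) := by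
  unfold hypot; fun_prop

/-- Twice the signed area of the triangle spanned by the points `(0, t)`, `(-qa, va)` and
`(-qb, vb)`. -/
def cross (qa qb va vb t : ℝ) : ℝ := (t - va) * qb - (t - vb) * qa

/-- The ratio between `cross` and `ra * rb` times the derivative of `ra - rb`. -/
def crossRatio (qa qb va vb t : ℝ) : ℝ :=
  (hypot qa va t * hypot qb vb t + (t - va) * (t - vb) + qa * qb) /
    (qa * hypot qb vb t + qb * hypot qa va t)

/-- The derivative of `crossRatio`. -/
def crossRatioDeriv (qa qb va vb t : ℝ) : ℝ :=
  (((t - va) / hypot qa va t * hypot qb vb t + hypot qa va t * ((t - vb) / hypot qb vb t) +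
      ((t - vb) + (t - va))) * (qa * hypot qb vb t + qb * hypot qa va t) -
    (hypot qa va t * hypot qb vb t + (t - va) * (t - vb) + qa * qb) *
      (qa * ((t - vb) / hypot qb vb t) + qb * ((t - va) / hypot qa va t))) /
    (qa * hypot qb vb t + qb * hypot qa va t) ^ 2

section
variable {qa qb : ℝ} (hqa : 0 < qa) (hqb : 0 < qb) (va vb t : ℝ)
include hqa hqb

theorem crossRatio_denom_pos : 0 < qa * hypot qb vb t + qb * hypot qa va t := by
  have := hypot_pos hqa va t
  have := hypot_pos hqb vb t
  positivity

/-- Let `α`, `β` be the angles of the two rays with the horizontal. The phase derivative is `sin α -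
sin β`, the right side is `sin (α - β)`, and `crossRatio` is `(1 + cos (α - β)) / (cos α + cos β)`.
This form of the quotient stays regular where both sides vanish. -/
theorem deriv_mul_crossRatio :
    ((t - va) / hypot qa va t - (t - vb) / hypot qb vb t) * crossRatio qa qb va vb t =
      cross qa qb va vb t / (hypot qa va t * hypot qb vb t) := by
  have h1 := hypot_pos hqa va t
  have h2 := hypot_pos hqb vb t
  have h3 := crossRatio_denom_pos hqa hqb va vb t
  have e1 := hypot_sq qa va t
  have e2 := hypot_sq qb vb t
  unfold crossRatio cross
  generalize hypot qa va t = ra at *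
  generalize hypot qb vb t = rb at *
  rw [div_sub_div _ _ h1.ne' h2.ne', div_mul_div_comm, div_eq_div_iff (by positivity) (by positivity)]
  linear_combination (ra * rb) * (-(t - vb) * rb * e1 + (t - va) * ra * e2)

theorem hasDerivAt_crossRatio :
    HasDerivAt (crossRatio qa qb va vb) (crossRatioDeriv qa qb va vb t) t := by
  have h3 := crossRatio_denom_pos hqa hqb va vb t
  have d1 := hasDerivAt_hypot hqa va t
  have d2 := hasDerivAt_hypot hqb vb t
  have p1 : HasDerivAt (fun t => t - va) 1 t := (hasDerivAt_id t).sub_const va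
  have p2 : HasDerivAt (fun t => t - vb) 1 t := (hasDerivAt_id t).sub_const vb
  have n := (((d1.mul d2).add (p1.mul p2)).add_const (qa * qb))
  have m := (d2.const_mul qa).add (d1.const_mul qb)
  have := n.div m h3.ne'
  refine this.congr_deriv ?_
  simp only [crossRatioDeriv, Pi.mul_apply, Pi.add_apply, one_mul, mul_one]

omit hqa hqb in
theorem hasDerivAt_cross :
    HasDerivAt (cross qa qb va vb) (qb - qa) t := by
  have p1 : HasDerivAt (fun t => t - va) 1 t := (hasDerivAt_id t).sub_const va
  have p2 : HasDerivAt (fun t => t - vb) 1 t := (hasDerivAt_id t).sub_const vb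
  exact ((p1.mul_const qb).sub (p2.mul_const qa)).congr_deriv (by ring)

theorem continuous_crossRatioDeriv : Continuous (crossRatioDeriv qa qb va vb) := by
  have c1 := continuous_hypot qa va
  have c2 := continuous_hypot qb vb
  have h1 := fun t => (hypot_pos hqa va t).ne'
  have h2 := fun t => (hypot_pos hqb vb t).ne'
  unfold crossRatioDeriv
  refine Continuous.div ?_ (by fun_prop) fun t =>
    pow_ne_zero 2 (crossRatio_denom_pos hqa hqb va vb t).ne'
  fun_prop (disch := assumption)

theorem abs_crossRatio_le (ha : |t - va| ≤ qa) (hb : |t - vb| ≤ qb) :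
    |crossRatio qa qb va vb t| ≤ 2 := by
  have h1 := hypot_pos hqa va t
  have h2 := hypot_pos hqb vb t
  have h3 := crossRatio_denom_pos hqa hqb va vb t
  have l1 := hypot_le hqa ha
  have l2 := hypot_le hqb hb
  have k1 := abs_sub_le_hypot qa va t
  have k2 := abs_sub_le_hypot qb vb t
  have m1 := le_hypot qa va t
  have m2 := le_hypot qb vb t
  unfold crossRatio
  rw [abs_div, abs_of_pos h3, div_le_iff₀ h3]
  generalize hypot qa va t = ra at *
  generalize hypot qb vb t = rb at *
  refine (abs_add_three _ _ _).trans ?_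
  rw [abs_mul (t - va), abs_of_pos (mul_pos h1 h2), abs_of_pos (mul_pos hqa hqb)]
  nlinarith [mul_le_mul k1 k2 (abs_nonneg _) h1.le, mul_le_mul_of_nonneg_right l1 h2.le,
    mul_le_mul_of_nonneg_left l2 h1.le, mul_le_mul_of_nonneg_right m2 hqa.le,
    mul_le_mul ha hb (abs_nonneg _) hqa.le]

theorem abs_crossRatioDeriv_le {d : ℝ} (hd : 0 < d) (hda : d ≤ qa) (hdb : d ≤ qb)
    (ha : |t - va| ≤ qa) (hb : |t - vb| ≤ qb) :
    |crossRatioDeriv qa qb va vb t| ≤ 6 / d := by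
  have h1 := hypot_pos hqa va t
  have h2 := hypot_pos hqb vb t
  have h3 := crossRatio_denom_pos hqa hqb va vb t
  have l1 := hypot_le hqa ha
  have l2 := hypot_le hqb hb
  have k1 := abs_sub_le_hypot qa va t
  have k2 := abs_sub_le_hypot qb vb t
  have m1 := le_hypot qa va t
  have m2 := le_hypot qb vb t
  have e1 := hypot_sq qa va t
  have e2 := hypot_sq qb vb t
  unfold crossRatioDeriv
  generalize hypot qa va t = ra at *
  generalize hypot qb vb t = rb at *
  have f1 : |(t - va) / ra| ≤ 1 := by rw [abs_div, abs_of_pos h1]; exact (div_le_one h1).2 k1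
  have f2 : |(t - vb) / rb| ≤ 1 := by rw [abs_div, abs_of_pos h2]; exact (div_le_one h2).2 k2
  have B1 : |(t - va) / ra * rb + ra * ((t - vb) / rb) + ((t - vb) + (t - va))| ≤
      2 * (ra + rb) := by
    refine (abs_add_le _ _).trans ?_
    have := abs_add_le ((t - va) / ra * rb) (ra * ((t - vb) / rb))
    have := abs_add_le (t - vb) (t - va)
    rw [abs_mul, abs_mul ra, abs_of_pos h1, abs_of_pos h2] at *
    nlinarith
  have B2 : |ra * rb + (t - va) * (t - vb) + qa * qb| ≤ 2 * (ra * rb) := by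
    -- Cauchy–Schwarz for the vectors `(|t - va|, qa)` and `(|t - vb|, qb)`.
    have hCS : |t - va| * |t - vb| + qa * qb ≤ ra * rb := by
      refine abs_le_of_sq_le_sq' ?_ (by positivity) |>.2
      rw [mul_pow, e1, e2, ← sq_abs (t - va), ← sq_abs (t - vb)]
      nlinarith [sq_nonneg (|t - va| * qb - |t - vb| * qa)]
    refine (abs_add_three _ _ _).trans ?_
    rw [abs_mul (t - va), abs_of_pos (mul_pos h1 h2), abs_of_pos (mul_pos hqa hqb)]
    linarith
  have B3 : |qa * ((t - vb) / rb) + qb * ((t - va) / ra)| ≤ ra + rb := by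
    refine (abs_add_le _ _).trans ?_
    rw [abs_mul, abs_mul qb, abs_of_pos hqa, abs_of_pos hqb]
    nlinarith
  -- Each leg `q` is at least two thirds of its hypotenuse.
  have B4 : 4 / 3 * (ra * rb) ≤ qa * rb + qb * ra := by nlinarith
  have hinv : ra + rb ≤ 2 * (ra * rb) / d := by
    rw [le_div_iff₀ hd]
    nlinarith [mul_le_mul_of_nonneg_right (hda.trans m1) h2.le,
      mul_le_mul_of_nonneg_right (hdb.trans m2) h1.le]
  set P := ra * rb with hP
  set Q := qa * rb + qb * ra with hQ
  have hPp : 0 < P := mul_pos h1 h2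
  rw [abs_div, abs_of_pos (by positivity : 0 < Q ^ 2), div_le_iff₀ (by positivity)]
  have hs : 0 < ra + rb := by positivity
  calc _ ≤ 2 * (ra + rb) * Q + 2 * P * (ra + rb) := by
        refine (abs_sub _ _).trans ?_
        rw [abs_mul, abs_mul, abs_of_pos h3]
        gcongr
    _ ≤ 2 * (ra + rb) * Q + 3 / 2 * Q * (ra + rb) := by
        have := mul_le_mul_of_nonneg_right B4 hs.le
        nlinarith
    _ = 7 / 2 * Q * (ra + rb) := by ring
    _ ≤ 7 / 2 * Q * (2 * P / d) := by gcongr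
    _ = 7 / d * Q * P := by ring
    _ ≤ 7 / d * Q * (3 / 4 * Q) := by
        have : P ≤ 3 / 4 * Q := by linarith
        gcongr
    _ ≤ 6 / d * Q ^ 2 := by
        have : 0 < Q ^ 2 / d := by positivity
        have e1 : 7 / d * Q * (3 / 4 * Q) = 21 / 4 * (Q ^ 2 / d) := by ring
        have e2 : 6 / d * Q ^ 2 = 6 * (Q ^ 2 / d) := by ring
        rw [e1, e2]; linarith

end

/-! ### The interference integral over one column of receivers. -/

/-- The interference of two transmitters along a vertical segment of receivers. -/
def fringe (qa qb va vb t : ℝ) : ℂ :=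
  ((1 / (hypot qa va t * hypot qb vb t) : ℝ) : ℂ) *
    Complex.exp ((2 * Real.pi * (hypot qa va t - hypot qb vb t) : ℝ) * Complex.I)

section
variable {qa qb : ℝ} (hqa : 0 < qa) (hqb : 0 < qb) (va vb t : ℝ)
include hqa hqb

theorem continuous_fringe : Continuous (fringe qa qb va vb) := by
  have c1 := continuous_hypot qa va
  have c2 := continuous_hypot qb vb
  have h : ∀ t, hypot qa va t * hypot qb vb t ≠ 0 := fun t =>
    (mul_pos (hypot_pos hqa va t) (hypot_pos hqb vb t)).ne'
  unfold fringe
  have : Continuous fun t => 1 / (hypot qa va t * hypot qb vb t) :=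
    continuous_const.div (c1.mul c2) h
  fun_prop

theorem norm_fringe_le {d : ℝ} (hd : 0 < d) (hda : d ≤ qa) (hdb : d ≤ qb) :
    ‖fringe qa qb va vb t‖ ≤ 1 / d ^ 2 := by
  have h1 := hypot_pos hqa va t
  have h2 := hypot_pos hqb vb t
  have m1 := hda.trans (le_hypot qa va t)
  have m2 := hdb.trans (le_hypot qb vb t)
  rw [fringe, norm_mul, Complex.norm_exp_ofReal_mul_I, mul_one, Complex.norm_real,
    Real.norm_eq_abs, abs_of_pos (by positivity)]
  refine one_div_le_one_div_of_le (by positivity) ?_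
  nlinarith

end

section
variable {qa qb va vb d D : ℝ} (hd : 0 < d) (hD : 0 < D) (hDd : D ≤ d)
  (hda : d ≤ qa) (hdb : d ≤ qb) (hva : va ∈ Set.Icc 0 D) (hvb : vb ∈ Set.Icc 0 D)

theorem abs_sub_le_of_mem_Icc {t v D q : ℝ} (ht : t ∈ Set.Icc 0 D) (hv : v ∈ Set.Icc 0 D)
    (h : D ≤ q) : |t - v| ≤ q :=
  abs_le.2 ⟨by linarith [ht.1, ht.2, hv.1, hv.2], by linarith [ht.1, ht.2, hv.1, hv.2]⟩

include hd hD hDd hda hdb hva hvb in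
-- By `deriv_mul_crossRatio` the amplitude of `fringe` is the derivative of `ra - rb` times
-- `crossRatio / cross`. The factor `c² / (c² + l²)` turns the singular `1 / c` into `g = c / (c² +
-- l²)`, with `|g'| ≤ |qb - qa| / (c² + l²)`. In `10 κ`, the two endpoints give `4 κ` and the
-- derivative of `crossRatio` gives `6 κ`.
theorem norm_integral_fringe_smoothed_le {l κ : ℝ}
    (hpos : ∀ t ∈ Set.Icc 0 D, 0 < cross qa qb va vb t ^ 2 + l ^ 2)
    (hκ : ∀ t ∈ Set.Icc 0 D,
      |cross qa qb va vb t| / (cross qa qb va vb t ^ 2 + l ^ 2) ≤ κ) :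
    2 * Real.pi * ‖∫ t in (0 : ℝ)..D,
      ((cross qa qb va vb t ^ 2 / (cross qa qb va vb t ^ 2 + l ^ 2) : ℝ) : ℂ) *
        fringe qa qb va vb t‖ ≤
      10 * κ + 2 * ∫ t in (0 : ℝ)..D, |qb - qa| / (cross qa qb va vb t ^ 2 + l ^ 2) := by
  have hqa := hd.trans_le hda
  have hqb := hd.trans_le hdb
  set c := cross qa qb va vb with hc
  have dc : ∀ t, HasDerivAt c (qb - qa) t := hasDerivAt_cross va vb
  have cc : Continuous c := continuous_iff_continuousAt.2 fun t => (dc t).continuousAt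
  have cβ : Continuous (crossRatio qa qb va vb) :=
    continuous_iff_continuousAt.2 fun t => (hasDerivAt_crossRatio hqa hqb va vb t).continuousAt
  set g : ℝ → ℝ := fun t => c t / (c t ^ 2 + l ^ 2) with hg
  set g' : ℝ → ℝ := fun t => (qb - qa) * (l ^ 2 - c t ^ 2) / (c t ^ 2 + l ^ 2) ^ 2 with hg'
  have dg : ∀ t ∈ Set.Icc 0 D, HasDerivAt g (g' t) t := by
    intro t ht
    have := (dc t).div (((dc t).pow 2).add_const (l ^ 2)) (hpos t ht).ne'
    refine this.congr_deriv ?_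
    simp only [hg', Pi.pow_apply]
    congr 1
    push_cast
    ring
  have hne : ∀ t ∈ Set.Icc 0 D, c t ^ 2 + l ^ 2 ≠ 0 := fun t ht => (hpos t ht).ne'
  have cg : ContinuousOn g (Set.Icc 0 D) := by
    exact cc.continuousOn.div (by fun_prop) hne
  have cg' : ContinuousOn g' (Set.Icc 0 D) := by
    exact ContinuousOn.div (by fun_prop) (by fun_prop) fun t ht => pow_ne_zero 2 (hne t ht)
  have cq : ContinuousOn (fun t => |qb - qa| / (c t ^ 2 + l ^ 2)) (Set.Icc 0 D) :=
    continuousOn_const.div (by fun_prop) hne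
  have gle : ∀ t ∈ Set.Icc 0 D, |g t| ≤ κ := by
    intro t ht
    rw [hg, abs_div, abs_of_pos (hpos t ht)]
    exact hκ t ht
  have g'le : ∀ t ∈ Set.Icc 0 D, |g' t| ≤ |qb - qa| / (c t ^ 2 + l ^ 2) := by
    intro t ht
    have h := hpos t ht
    simp only [hg']
    rw [abs_div, abs_mul, abs_of_pos (pow_pos h 2), div_le_div_iff₀ (pow_pos h 2) h]
    have : |l ^ 2 - c t ^ 2| ≤ c t ^ 2 + l ^ 2 :=
      abs_le.2 ⟨by nlinarith [sq_nonneg l], by nlinarith [sq_nonneg (c t)]⟩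
    calc |qb - qa| * |l ^ 2 - c t ^ 2| * (c t ^ 2 + l ^ 2)
        ≤ |qb - qa| * (c t ^ 2 + l ^ 2) * (c t ^ 2 + l ^ 2) := by gcongr
      _ = _ := by ring
  have hκ0 : 0 ≤ κ := (abs_nonneg _).trans (gle 0 ⟨le_rfl, hD.le⟩)
  have βle : ∀ t ∈ Set.Icc 0 D, |crossRatio qa qb va vb t| ≤ 2 := fun t ht =>
    abs_crossRatio_le hqa hqb va vb t (abs_sub_le_of_mem_Icc ht hva (hDd.trans hda))
      (abs_sub_le_of_mem_Icc ht hvb (hDd.trans hdb))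
  have β'le : ∀ t ∈ Set.Icc 0 D, |crossRatioDeriv qa qb va vb t| ≤ 6 / d := fun t ht =>
    abs_crossRatioDeriv_le hqa hqb va vb t hd hda hdb
      (abs_sub_le_of_mem_Icc ht hva (hDd.trans hda))
      (abs_sub_le_of_mem_Icc ht hvb (hDd.trans hdb))
  have cβ' := continuous_crossRatioDeriv hqa hqb va vb
  have key := norm_integral_deriv_mul_exp_le hD.le
    (φ := fun t => 2 * Real.pi * (hypot qa va t - hypot qb vb t))
    (φ' := fun t => 2 * Real.pi * ((t - va) / hypot qa va t - (t - vb) / hypot qb vb t))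
    (w := fun t => crossRatio qa qb va vb t * g t)
    (w' := fun t => crossRatioDeriv qa qb va vb t * g t + crossRatio qa qb va vb t * g' t)
    (fun t _ => ((hasDerivAt_hypot hqa va t).sub (hasDerivAt_hypot hqb vb t)).const_mul _)
    (fun t ht => (hasDerivAt_crossRatio hqa hqb va vb t).mul (dg t ht))
    (by
      have c1 := continuous_hypot qa va
      have c2 := continuous_hypot qb vb
      have h1 := fun t => (hypot_pos hqa va t).ne'
      have h2 := fun t => (hypot_pos hqb vb t).ne'
      refine Continuous.continuousOn ?_
      fun_prop (disch := assumption))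
    ((cβ'.continuousOn.mul cg).add (cβ.continuousOn.mul cg'))
  have heq : (∫ t in (0 : ℝ)..D, ((2 * Real.pi * ((t - va) / hypot qa va t -
        (t - vb) / hypot qb vb t) * (crossRatio qa qb va vb t * g t) : ℝ) : ℂ) *
        Complex.exp ((2 * Real.pi * (hypot qa va t - hypot qb vb t) : ℝ) * Complex.I)) =
      (2 * Real.pi : ℝ) * ∫ t in (0 : ℝ)..D, ((c t ^ 2 / (c t ^ 2 + l ^ 2) : ℝ) : ℂ) *
        fringe qa qb va vb t := by
    rw [← intervalIntegral.integral_const_mul]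
    congr 1
    ext t
    have h := deriv_mul_crossRatio hqa hqb va vb t
    have e : 2 * Real.pi * ((t - va) / hypot qa va t - (t - vb) / hypot qb vb t) *
        (crossRatio qa qb va vb t * g t) = 2 * Real.pi * (c t ^ 2 / (c t ^ 2 + l ^ 2)) *
          (1 / (hypot qa va t * hypot qb vb t)) := by
      calc _ = 2 * Real.pi * (((t - va) / hypot qa va t - (t - vb) / hypot qb vb t) *
            crossRatio qa qb va vb t) * g t := by ring
        _ = _ := by rw [h]; simp only [hg, ← hc]; ring
    rw [e, fringe, Complex.ofReal_mul, Complex.ofReal_mul (2 * Real.pi)]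
    ring
  rw [heq, norm_mul, Complex.norm_real, Real.norm_eq_abs, abs_of_pos Real.two_pi_pos] at key
  refine key.trans ?_
  have hw : ∀ t ∈ Set.Icc 0 D, |crossRatio qa qb va vb t * g t| ≤ 2 * κ := fun t ht => by
    rw [abs_mul]
    exact mul_le_mul (βle t ht) (gle t ht) (abs_nonneg _) (by norm_num)
  have hint : ∫ t in (0 : ℝ)..D,
      |crossRatioDeriv qa qb va vb t * g t + crossRatio qa qb va vb t * g' t| ≤
      ∫ t in (0 : ℝ)..D, (6 / d * κ + 2 * (|qb - qa| / (c t ^ 2 + l ^ 2))) := by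
    refine intervalIntegral.integral_mono_on hD.le ?_ ?_ fun t ht => ?_
    · exact ((cβ'.continuousOn.mul cg).add (cβ.continuousOn.mul cg')).abs.intervalIntegrable_of_Icc
        hD.le
    · exact (continuousOn_const.add (continuousOn_const.mul cq)).intervalIntegrable_of_Icc hD.le
    · refine (abs_add_le _ _).trans ?_
      rw [abs_mul, abs_mul]
      exact add_le_add (mul_le_mul (β'le t ht) (gle t ht) (abs_nonneg _) (by positivity))
        (mul_le_mul (βle t ht) (g'le t ht) (abs_nonneg _) (by norm_num))
  have hq : IntervalIntegrable (fun t => 2 * (|qb - qa| / (c t ^ 2 + l ^ 2))) volume 0 D :=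
    (continuousOn_const.mul cq).intervalIntegrable_of_Icc hD.le
  rw [intervalIntegral.integral_add (by simp) hq,
    intervalIntegral.integral_const, intervalIntegral.integral_const_mul, smul_eq_mul, sub_zero]
    at hint
  have h6 : D * (6 / d * κ) ≤ 6 * κ := by
    have : D / d ≤ 1 := (div_le_one hd).2 hDd
    calc D * (6 / d * κ) = D / d * (6 * κ) := by ring
      _ ≤ 1 * (6 * κ) := by gcongr
      _ = _ := one_mul _
  linarith [hw 0 ⟨le_rfl, hD.le⟩, hw D ⟨hD.le, le_rfl⟩]

theorem cross_eq (qa qb va vb t : ℝ) :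
    cross qa qb va vb t = cross qa qb va vb 0 + (qb - qa) * t := by
  unfold cross; ring

include hd hD hDd hda hdb hva hvb in
-- Over the segment `cross` changes by at most half of its value at `0`, so it has no zero and no
-- smoothing is needed: `l = 0` and `κ = 2 / c0`. The total `20 / c0 + 4 / c0` is at most `2π · 4 /
-- c0`.
theorem norm_integral_fringe_le_of_far (h0 : cross qa qb va vb 0 ≠ 0)
    (hfar : 2 * (|qb - qa| * D) ≤ |cross qa qb va vb 0|) :
    ‖∫ t in (0 : ℝ)..D, fringe qa qb va vb t‖ ≤ 4 / |cross qa qb va vb 0| := by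
  set c0 := |cross qa qb va vb 0| with hc0
  have hc0p : 0 < c0 := abs_pos.2 h0
  have hge : ∀ t ∈ Set.Icc 0 D, c0 / 2 ≤ |cross qa qb va vb t| := by
    intro t ht
    rw [cross_eq]
    have h1 : |(qb - qa) * t| ≤ |qb - qa| * D := by
      rw [abs_mul, abs_of_nonneg ht.1]
      exact mul_le_mul_of_nonneg_left ht.2 (abs_nonneg _)
    have := abs_sub_abs_le_abs_sub (cross qa qb va vb 0) (-((qb - qa) * t))
    rw [abs_neg, sub_neg_eq_add] at this
    linarith
  have hsq : ∀ t ∈ Set.Icc 0 D, c0 ^ 2 / 4 ≤ cross qa qb va vb t ^ 2 := by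
    intro t ht
    rw [← sq_abs (cross qa qb va vb t)]
    nlinarith [hge t ht]
  have hpos : ∀ t ∈ Set.Icc 0 D, 0 < cross qa qb va vb t ^ 2 + (0 : ℝ) ^ 2 := by
    intro t ht
    have := hsq t ht
    have : 0 < c0 ^ 2 / 4 := by positivity
    linarith
  have key := norm_integral_fringe_smoothed_le hd hD hDd hda hdb hva hvb (l := 0) (κ := 2 / c0) hpos
    (by
      intro t ht
      have h1 := hge t ht
      have h2 : 0 < |cross qa qb va vb t| := by linarith
      rw [← sq_abs (cross qa qb va vb t)]
      rw [div_le_div_iff₀ (by positivity) hc0p]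
      nlinarith)
  have heq : (∫ t in (0 : ℝ)..D, ((cross qa qb va vb t ^ 2 /
      (cross qa qb va vb t ^ 2 + (0 : ℝ) ^ 2) : ℝ) : ℂ) * fringe qa qb va vb t) =
      ∫ t in (0 : ℝ)..D, fringe qa qb va vb t := by
    refine intervalIntegral.integral_congr fun t ht => ?_
    rw [Set.uIcc_of_le hD.le] at ht
    have := hpos t ht
    rw [zero_pow two_ne_zero, add_zero] at this
    simp only [zero_pow two_ne_zero, add_zero, div_self this.ne', Complex.ofReal_one, one_mul]
  rw [heq] at key
  have hint : ∫ t in (0 : ℝ)..D, |qb - qa| / (cross qa qb va vb t ^ 2 + (0 : ℝ) ^ 2) ≤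
      ∫ t in (0 : ℝ)..D, |qb - qa| * (4 / c0 ^ 2) := by
    have cc : Continuous (cross qa qb va vb) :=
      continuous_iff_continuousAt.2 fun t => (hasDerivAt_cross va vb t).continuousAt
    refine intervalIntegral.integral_mono_on hD.le ?_ (by simp) fun t ht => ?_
    · exact (continuousOn_const.div (by fun_prop) fun t ht => (hpos t ht).ne').intervalIntegrable_of_Icc
        hD.le
    · rw [div_eq_mul_inv]
      refine mul_le_mul_of_nonneg_left ?_ (abs_nonneg _)
      have h1 := hsq t ht
      have h3 := hpos t ht
      rw [inv_eq_one_div, div_le_div_iff₀ h3 (by positivity)]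
      linarith
  rw [intervalIntegral.integral_const, smul_eq_mul, sub_zero] at hint
  have h2 : D * (|qb - qa| * (4 / c0 ^ 2)) ≤ 2 / c0 := by
    calc D * (|qb - qa| * (4 / c0 ^ 2)) = 2 * (|qb - qa| * D) * (2 / c0 ^ 2) := by ring
      _ ≤ c0 * (2 / c0 ^ 2) := by gcongr
      _ = 2 / c0 := by field_simp
  have hpi := Real.pi_gt_three
  have e1 : 10 * (2 / c0) = 20 / c0 := by ring
  have e2 : 4 / c0 * 6 = 20 / c0 + 2 * (2 / c0) := by ring
  have hn := norm_nonneg (∫ t in (0 : ℝ)..D, fringe qa qb va vb t)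
  nlinarith

/-- The arctangent primitive has total variation at most `π / l`, whatever the slope, the offset and
the interval. -/
theorem integral_inv_sq_add_sq_le {m b l a : ℝ} (hm : m ≠ 0) (hl : 0 < l) :
    ∫ t in (0 : ℝ)..a, |m| / ((b + m * t) ^ 2 + l ^ 2) ≤ Real.pi / l := by
  have hd : ∀ t ∈ Set.uIcc 0 a, HasDerivAt (fun t => |m| / (m * l) * Real.arctan ((b + m * t) / l))
      (|m| / ((b + m * t) ^ 2 + l ^ 2)) t := by
    intro t _
    have h1 : HasDerivAt (fun t => (b + m * t) / l) (m / l) t := by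
      have := (((hasDerivAt_id t).const_mul m).const_add b).div_const l
      exact this.congr_deriv (by simp)
    refine (h1.arctan.const_mul (|m| / (m * l))).congr_deriv ?_
    have : (b + m * t) ^ 2 + l ^ 2 ≠ 0 := by positivity
    have : 1 + ((b + m * t) / l) ^ 2 ≠ 0 := by positivity
    field_simp
    ring
  have hc : Continuous fun t => |m| / ((b + m * t) ^ 2 + l ^ 2) :=
    continuous_const.div (by fun_prop) fun t => by positivity
  rw [intervalIntegral.integral_eq_sub_of_hasDerivAt hd (hc.intervalIntegrable _ _), ← mul_sub]
  refine (le_abs_self _).trans ?_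
  rw [abs_mul, abs_div, abs_abs, abs_mul, abs_of_pos hl]
  have e : |m| / (|m| * l) = 1 / l := by
    have := abs_pos.2 hm
    field_simp
  rw [e]
  have : |Real.arctan ((b + m * a) / l) - Real.arctan ((b + m * 0) / l)| ≤ Real.pi :=
    abs_le.2 ⟨by linarith [Real.neg_pi_div_two_lt_arctan ((b + m * a) / l),
      Real.arctan_lt_pi_div_two ((b + m * 0) / l)],
      by linarith [Real.neg_pi_div_two_lt_arctan ((b + m * 0) / l),
      Real.arctan_lt_pi_div_two ((b + m * a) / l)]⟩
  calc 1 / l * _ ≤ 1 / l * Real.pi := by gcongr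
    _ = _ := by ring

include hd hD hDd hda hdb hva hvb in
-- `cross` may vanish here. The choice `l² = d² |qb - qa|` balances the smoothed part, estimated by
-- parts, against the removed part, estimated in modulus through `‖fringe‖ ≤ 1 / d²`; both are of
-- order `1 / l`.
theorem norm_integral_fringe_le_of_ne (hne : qa ≠ qb) :
    ‖∫ t in (0 : ℝ)..D, fringe qa qb va vb t‖ ≤ 6 / (d * √|qb - qa|) := by
  have hqa := hd.trans_le hda
  have hqb := hd.trans_le hdb
  have hm : qb - qa ≠ 0 := sub_ne_zero.2 hne.symm
  set δ := |qb - qa| with hδ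
  have hδp : 0 < δ := abs_pos.2 hm
  set l := d * √δ with hl
  have hlp : 0 < l := by positivity
  have hl2 : l ^ 2 = d ^ 2 * δ := by rw [hl, mul_pow, Real.sq_sqrt hδp.le]
  have cc : Continuous (cross qa qb va vb) :=
    continuous_iff_continuousAt.2 fun t => (hasDerivAt_cross va vb t).continuousAt
  have hpos : ∀ t, 0 < cross qa qb va vb t ^ 2 + l ^ 2 := fun t => by positivity
  -- The value of `κ` is the AM-GM bound `2 |c| l ≤ c² + l²`.
  have key := norm_integral_fringe_smoothed_le hd hD hDd hda hdb hva hvb (l := l) (κ := 1 / (2 * l))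
    (fun t _ => hpos t)
    (by
      intro t ht
      rw [div_le_div_iff₀ (hpos t) (by positivity)]
      nlinarith [sq_nonneg (|cross qa qb va vb t| - l), sq_abs (cross qa qb va vb t)])
  have hint : ∫ t in (0 : ℝ)..D, δ / (cross qa qb va vb t ^ 2 + l ^ 2) ≤ Real.pi / l := by
    have := integral_inv_sq_add_sq_le (b := cross qa qb va vb 0) (a := D) hm hlp
    simpa only [← cross_eq] using this
  have c1 : Continuous fun t => ((cross qa qb va vb t ^ 2 /
      (cross qa qb va vb t ^ 2 + l ^ 2) : ℝ) : ℂ) * fringe qa qb va vb t := by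
    refine (Complex.continuous_ofReal.comp (Continuous.div (by fun_prop) (by fun_prop)
      fun t => (hpos t).ne')).mul (continuous_fringe hqa hqb va vb)
  have cδ : Continuous fun t => δ / (cross qa qb va vb t ^ 2 + l ^ 2) :=
    continuous_const.div (by fun_prop) fun t => (hpos t).ne'
  have c2 : Continuous fun t => ((d ^ 2 * (δ / (cross qa qb va vb t ^ 2 + l ^ 2)) : ℝ) : ℂ) *
      fringe qa qb va vb t :=
    (Complex.continuous_ofReal.comp (continuous_const.mul cδ)).mul (continuous_fringe hqa hqb va vb)
  have hsplit : ∫ t in (0 : ℝ)..D, fringe qa qb va vb t =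
      (∫ t in (0 : ℝ)..D, ((cross qa qb va vb t ^ 2 /
        (cross qa qb va vb t ^ 2 + l ^ 2) : ℝ) : ℂ) * fringe qa qb va vb t) +
      ∫ t in (0 : ℝ)..D, ((d ^ 2 * (δ / (cross qa qb va vb t ^ 2 + l ^ 2)) : ℝ) : ℂ) *
        fringe qa qb va vb t := by
    rw [← intervalIntegral.integral_add (c1.intervalIntegrable _ _) (c2.intervalIntegrable _ _)]
    congr 1
    ext t
    rw [← add_mul, ← Complex.ofReal_add, mul_div_assoc', ← hl2, ← add_div, div_self (hpos t).ne',
      Complex.ofReal_one, one_mul]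
  have h2 : ‖∫ t in (0 : ℝ)..D, ((d ^ 2 * (δ / (cross qa qb va vb t ^ 2 + l ^ 2)) : ℝ) : ℂ) *
        fringe qa qb va vb t‖ ≤ Real.pi / l := by
    refine le_trans ?_ hint
    refine (intervalIntegral.norm_integral_le_integral_norm hD.le).trans ?_
    refine intervalIntegral.integral_mono_on hD.le (c2.norm.intervalIntegrable _ _)
      (cδ.intervalIntegrable _ _) fun t _ => ?_
    have := norm_fringe_le hqa hqb va vb t hd hda hdb
    have h3 : 0 ≤ δ / (cross qa qb va vb t ^ 2 + l ^ 2) := div_nonneg hδp.le (hpos t).le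
    rw [norm_mul, Complex.norm_real, Real.norm_eq_abs, abs_of_nonneg (by positivity)]
    calc d ^ 2 * (δ / (cross qa qb va vb t ^ 2 + l ^ 2)) * ‖fringe qa qb va vb t‖
        ≤ d ^ 2 * (δ / (cross qa qb va vb t ^ 2 + l ^ 2)) * (1 / d ^ 2) := by gcongr
      _ = _ := by field_simp
  rw [hsplit]
  refine (norm_add_le _ _).trans ?_
  have hp3 := Real.pi_gt_three
  have hp4 := Real.pi_lt_d2
  set N := ‖∫ t in (0 : ℝ)..D, ((cross qa qb va vb t ^ 2 /
        (cross qa qb va vb t ^ 2 + l ^ 2) : ℝ) : ℂ) * fringe qa qb va vb t‖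
  have hN : N ≤ 2 / l := by
    have h5 : 2 * Real.pi * N ≤ (5 + 2 * Real.pi) / l := by
      have : 10 * (1 / (2 * l)) + 2 * (Real.pi / l) = (5 + 2 * Real.pi) / l := by field_simp; ring
      linarith
    have h6 : (5 + 2 * Real.pi) / l ≤ 2 * Real.pi * (2 / l) := by
      rw [mul_div_assoc']
      gcongr
      linarith
    exact le_of_mul_le_mul_left (h5.trans h6) Real.two_pi_pos
  have h7 : Real.pi / l ≤ 4 / l := by gcongr; linarith
  have h8 : 2 / l + 4 / l = 6 / l := by ring
  linarith

end

/-! ### Uniform laws in Cartesian coordinates. -/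

/-- The uniform distribution on the interval `[a, b]`. -/
def uniformIcc (a b : ℝ) : Measure ℝ := ProbabilityTheory.cond volume (Set.Icc a b)

theorem uniformIcc_eq (a b : ℝ) :
    uniformIcc a b = (ENNReal.ofReal (b - a))⁻¹ • volume.restrict (Set.Icc a b) := by
  rw [uniformIcc, ProbabilityTheory.cond, Real.volume_Icc]

theorem isProbabilityMeasure_uniformIcc {a b : ℝ} (h : a < b) :
    IsProbabilityMeasure (uniformIcc a b) :=
  ProbabilityTheory.cond_isProbabilityMeasure_of_finite (by simpa using h) (by simp)

instance (a b : ℝ) : SFinite (uniformIcc a b) := by rw [uniformIcc_eq]; infer_instance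

theorem ae_uniformIcc (a b : ℝ) : ∀ᵐ x ∂uniformIcc a b, x ∈ Set.Icc a b :=
  ProbabilityTheory.ae_cond_mem measurableSet_Icc

/-- The plane in Cartesian coordinates. -/
def planeEquiv : ℝ × ℝ ≃ᵐ Plane :=
  (MeasurableEquiv.finTwoArrow (α := ℝ)).symm.trans (MeasurableEquiv.toLp 2 (Fin 2 → ℝ))

@[simp] theorem planeEquiv_zero (p : ℝ × ℝ) : planeEquiv p 0 = p.1 := rfl

@[simp] theorem planeEquiv_one (p : ℝ × ℝ) : planeEquiv p 1 = p.2 := rfl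

theorem measurePreserving_planeEquiv : MeasurePreserving planeEquiv volume volume :=
  (volume_preserving_finTwoArrow ℝ).symm.trans
    (EuclideanSpace.volume_preserving_symm_measurableEquiv_toLp (Fin 2)).symm

theorem uniformOn_box (a b c e : ℝ) :
    uniformOn {p | p 0 ∈ Set.Icc a b ∧ p 1 ∈ Set.Icc c e} =
      ((uniformIcc a b).prod (uniformIcc c e)).map planeEquiv := by
  have hpre : planeEquiv ⁻¹' {p | p 0 ∈ Set.Icc a b ∧ p 1 ∈ Set.Icc c e} =
      Set.Icc a b ×ˢ Set.Icc c e := by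
    ext p
    simp only [Set.mem_preimage, Set.mem_ofPred_eq, Set.mem_prod, planeEquiv_zero, planeEquiv_one]
  have h1 := (measurePreserving_planeEquiv.restrict_preimage_emb
    planeEquiv.measurableEmbedding {p | p 0 ∈ Set.Icc a b ∧ p 1 ∈ Set.Icc c e}).map_eq
  have h2 := measurePreserving_planeEquiv.measure_preimage_equiv
    {p | p 0 ∈ Set.Icc a b ∧ p 1 ∈ Set.Icc c e}
  rw [hpre] at h1 h2
  rw [uniformOn, ProbabilityTheory.cond, ← h1, ← h2, uniformIcc_eq, uniformIcc_eq,
    Measure.prod_smul_left, Measure.prod_smul_right, Measure.prod_restrict, smul_smul,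
    Measure.map_smul, Measure.volume_eq_prod, Measure.prod_prod, Real.volume_Icc, Real.volume_Icc,
    ENNReal.mul_inv (Or.inr ENNReal.ofReal_ne_top) (Or.inl ENNReal.ofReal_ne_top)]

/-! ### Mean square of the column average over the height of one transmitter. -/

section
variable {qa qb va vb d D : ℝ} (hd : 0 < d) (hD : 0 < D) (hDd : D ≤ d)
  (hda : d ≤ qa) (hdb : d ≤ qb)
include hd hD hDd hda hdb

/-- The first term covers the far case, the indicator the near case; the switch is at `y = va - vb
qa / qb`, since `cross` at `0` equals `-qb y`. The forms `|1|` and `1 * va` match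
`integral_inv_sq_add_sq_le` with slope `1`. -/
theorem norm_sq_average_fringe_le {va : ℝ} (hva : va ∈ Set.Icc 0 D) (hvb : vb ∈ Set.Icc 0 D) :
    ‖((d ^ 2 / D : ℝ) : ℂ) * ∫ t in (0 : ℝ)..D, fringe qa qb va vb t‖ ^ 2 ≤
      2 * (4 * d / D) ^ 2 * (|1| / ((-(vb * qa / qb) + 1 * va) ^ 2 + (4 * d / D) ^ 2)) +
      (Metric.ball (vb * qa / qb) (2 * |qb - qa| * D / d)).indicator
        (fun _ => 36 * d ^ 2 / (D ^ 2 * |qb - qa|)) va := by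
  have hqa := hd.trans_le hda
  have hqb := hd.trans_le hdb
  set I := ∫ t in (0 : ℝ)..D, fringe qa qb va vb t with hI
  have hN : ‖((d ^ 2 / D : ℝ) : ℂ) * I‖ = d ^ 2 / D * ‖I‖ := by
    rw [norm_mul, Complex.norm_real, Real.norm_eq_abs, abs_of_pos (by positivity)]
  rw [hN]
  set y := -(vb * qa / qb) + 1 * va with hy
  have hc0 : cross qa qb va vb 0 = -(qb * y) := by
    rw [cross, hy]; field_simp; ring
  have hmem : va ∈ Metric.ball (vb * qa / qb) (2 * |qb - qa| * D / d) ↔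
      |y| < 2 * |qb - qa| * D / d := by
    rw [Metric.mem_ball, Real.dist_eq, hy, one_mul, neg_add_eq_sub]
  have hball : 0 ≤ (Metric.ball (vb * qa / qb) (2 * |qb - qa| * D / d)).indicator
      (fun _ => 36 * d ^ 2 / (D ^ 2 * |qb - qa|)) va :=
    Set.indicator_nonneg (fun _ _ => by positivity) _
  have hfirst : 0 ≤ 2 * (4 * d / D) ^ 2 * (|1| / (y ^ 2 + (4 * d / D) ^ 2)) := by positivity
  by_cases hfar : 2 * (|qb - qa| * D) ≤ |cross qa qb va vb 0|
  · refine le_trans ?_ (le_add_of_nonneg_right hball)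
    have hρ : 0 < 4 * d / D := by positivity
    have hone : d ^ 2 / D * ‖I‖ ≤ 1 := by
      have : ‖I‖ ≤ 1 / d ^ 2 * |D - 0| :=
        intervalIntegral.norm_integral_le_of_norm_le_const fun t _ =>
          norm_fringe_le hqa hqb va vb t hd hda hdb
      rw [sub_zero, abs_of_pos hD] at this
      calc d ^ 2 / D * ‖I‖ ≤ d ^ 2 / D * (1 / d ^ 2 * D) := by gcongr
        _ = 1 := by field_simp
    have hone' : (d ^ 2 / D * ‖I‖) ^ 2 ≤ 1 := pow_le_one₀ (by positivity) hone
    have hyb : (d ^ 2 / D * ‖I‖) ^ 2 * y ^ 2 ≤ (4 * d / D) ^ 2 := by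
      rcases eq_or_ne y 0 with h0 | h0
      · rw [h0]; simp; positivity
      · have hcne : cross qa qb va vb 0 ≠ 0 := by
          rw [hc0]; exact neg_ne_zero.2 (mul_ne_zero hqb.ne' h0)
        have := norm_integral_fringe_le_of_far hd hD hDd hda hdb hva hvb hcne hfar
        rw [hc0, abs_neg, abs_mul, abs_of_pos hqb] at this
        have hyp := abs_pos.2 h0
        rw [← sq_abs y, ← mul_pow]
        refine pow_le_pow_left₀ (by positivity) ?_ 2
        calc d ^ 2 / D * ‖I‖ * |y| ≤ d ^ 2 / D * (4 / (qb * |y|)) * |y| := by gcongr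
          _ = 4 * d / D * (d / qb) := by field_simp
          _ ≤ 4 * d / D * 1 := by gcongr; exact (div_le_one hqb).2 hdb
          _ = _ := mul_one _
    -- The square `P` satisfies `P ≤ 1` and `P y² ≤ ρ²` with `ρ = 4 d / D`; adding gives `P (y² +
    -- ρ²) ≤ 2 ρ²`.
    rw [abs_one, mul_one_div, le_div_iff₀ (by positivity)]
    nlinarith [sq_nonneg (4 * d / D)]
  · push Not at hfar
    rw [hc0, abs_neg, abs_mul, abs_of_pos hqb] at hfar
    have hδ : 0 < |qb - qa| := by
      by_contra h
      have : |qb - qa| = 0 := le_antisymm (not_lt.1 h) (abs_nonneg _)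
      rw [this] at hfar
      nlinarith [mul_nonneg hqb.le (abs_nonneg y)]
    have hin : |y| < 2 * |qb - qa| * D / d := by
      rw [lt_div_iff₀ hd]
      nlinarith [mul_le_mul_of_nonneg_right hdb (abs_nonneg y)]
    rw [Set.indicator_of_mem (hmem.2 hin)]
    refine le_trans ?_ (le_add_of_nonneg_left hfirst)
    have hne : qa ≠ qb := fun h => by simp [h] at hδ
    have h2 := norm_integral_fringe_le_of_ne hd hD hDd hda hdb hva hvb hne
    rw [abs_sub_comm] at h2
    calc (d ^ 2 / D * ‖I‖) ^ 2 ≤ (d ^ 2 / D * (6 / (d * √|qb - qa|))) ^ 2 := by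
          gcongr
          simpa only [abs_sub_comm] using h2
      _ = 36 * d ^ 2 / (D ^ 2 * √|qb - qa| ^ 2) := by field_simp; norm_num
      _ = _ := by rw [Real.sq_sqrt hδ.le]

/-- The far term integrates to at most `2πρ ≤ 28 d / D`. In the near term the factor `|qb - qa|`
cancels between the height of the indicator and its length, leaving `144 d / D`. Dividing the sum by
`D` gives `172 d / D²`. -/
theorem lintegral_average_fringe_le (hvb : vb ∈ Set.Icc 0 D) :
    ∫⁻ va, ‖((d ^ 2 / D : ℝ) : ℂ) * ∫ t in (0 : ℝ)..D, fringe qa qb va vb t‖ₑ ^ 2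
      ∂(uniformIcc 0 D) ≤ ENNReal.ofReal (200 * (d / D ^ 2)) := by
  set c := vb * qa / qb with hc
  set ρ := 4 * d / D with hρ
  have hρp : 0 < ρ := by positivity
  set η := 2 * |qb - qa| * D / d with hη
  have hη0 : 0 ≤ η := by positivity
  set m := 36 * d ^ 2 / (D ^ 2 * |qb - qa|) with hm
  have hm0 : 0 ≤ m := by positivity
  set u : ℝ → ℝ := fun v => 2 * ρ ^ 2 * (|1| / ((-c + 1 * v) ^ 2 + ρ ^ 2)) with hu
  have hu0 : ∀ v, 0 ≤ u v := fun v => by positivity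
  have huc : Continuous u :=
    continuous_const.mul (continuous_const.div (by fun_prop) fun v => by positivity)
  rw [uniformIcc_eq, lintegral_smul_measure, sub_zero, smul_eq_mul]
  have h1 : ∫⁻ va in Set.Icc 0 D,
      ‖((d ^ 2 / D : ℝ) : ℂ) * ∫ t in (0 : ℝ)..D, fringe qa qb va vb t‖ₑ ^ 2 ≤
      ∫⁻ va in Set.Icc 0 D, (ENNReal.ofReal (u va) +
        (Metric.ball c η).indicator (fun _ => ENNReal.ofReal m) va) := by
    refine setLIntegral_mono' measurableSet_Icc fun va hva => ?_
    have h := norm_sq_average_fringe_le hd hD hDd hda hdb hva hvb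
    rw [← ofReal_norm, ← ENNReal.ofReal_pow (norm_nonneg _)]
    refine (ENNReal.ofReal_le_ofReal h).trans ?_
    refine ENNReal.ofReal_add_le.trans (add_le_add le_rfl (le_of_eq ?_))
    simp only [Set.indicator]
    split_ifs <;> simp [hm]
  have h2 : ∫⁻ va in Set.Icc 0 D, ENNReal.ofReal (u va) ≤ ENNReal.ofReal (7 * ρ) := by
    rw [← ofReal_integral_eq_lintegral_ofReal (huc.integrableOn_Icc) (Filter.Eventually.of_forall hu0)]
    refine ENNReal.ofReal_le_ofReal ?_
    rw [integral_Icc_eq_integral_Ioc, ← intervalIntegral.integral_of_le hD.le,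
      intervalIntegral.integral_const_mul]
    calc _ ≤ 2 * ρ ^ 2 * (Real.pi / ρ) := by
          gcongr
          exact integral_inv_sq_add_sq_le one_ne_zero hρp
      _ = 2 * Real.pi * ρ := by field_simp
      _ ≤ 7 * ρ := by
        have := Real.pi_lt_d2
        gcongr
        linarith
  have h3 : ∫⁻ va in Set.Icc 0 D, (Metric.ball c η).indicator (fun _ => ENNReal.ofReal m) va ≤
      ENNReal.ofReal (144 * d / D) := by
    refine (setLIntegral_le_lintegral _ _).trans ?_
    rw [lintegral_indicator_const measurableSet_ball, Real.volume_ball, ← ENNReal.ofReal_mul hm0]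
    refine ENNReal.ofReal_le_ofReal ?_
    -- If `qa = qb`, both the radius and, by `x / 0 = 0`, the constant `m` vanish.
    rcases eq_or_ne (|qb - qa|) 0 with h0 | h0
    · rw [hm, h0]; simp; positivity
    · refine le_of_eq ?_
      rw [hm, hη]; field_simp; norm_num
  rw [lintegral_add_left huc.measurable.ennreal_ofReal] at h1
  have h4 := h1.trans (add_le_add h2 h3)
  rw [← ENNReal.ofReal_add (by positivity) (by positivity)] at h4
  rw [mul_comm, ← div_eq_mul_inv]
  refine ENNReal.div_le_of_le_mul (h4.trans ?_)
  rw [← ENNReal.ofReal_mul (by positivity)]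
  refine ENNReal.ofReal_le_ofReal ?_
  have e1 : 200 * (d / D ^ 2) * D = 200 * (d / D) := by field_simp
  have e2 : 7 * ρ + 144 * d / D = 172 * (d / D) := by rw [hρ]; ring
  have : 0 < d / D := by positivity
  rw [e1, e2]
  linarith

end

/-! ### Measurability and size of the gains. -/

theorem measurable_normalizedGain {α : Type*} [MeasurableSpace α] {f g : α → Plane}
    (hf : Measurable f) (hg : Measurable g) (d : ℝ) :
    Measurable fun a => normalizedGain d (f a) (g a) := by
  unfold normalizedGain
  fun_prop

theorem measurable_conj_normalizedGain {α : Type*} [MeasurableSpace α] {f g : α → Plane}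
    (hf : Measurable f) (hg : Measurable g) (d : ℝ) :
    Measurable fun a => starRingEnd ℂ (normalizedGain d (f a) (g a)) :=
  Complex.continuous_conj.measurable.comp (measurable_normalizedGain hf hg d)

theorem measurable_gainCycle (d : ℝ) : Measurable (gainCycle d) := by
  have h11 : Measurable fun q : (Plane × Plane) × (Plane × Plane) => q.1.1 :=
    measurable_fst.comp measurable_fst
  have h12 : Measurable fun q : (Plane × Plane) × (Plane × Plane) => q.1.2 :=
    measurable_snd.comp measurable_fst
  have h21 : Measurable fun q : (Plane × Plane) × (Plane × Plane) => q.2.1 :=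
    measurable_fst.comp measurable_snd
  have h22 : Measurable fun q : (Plane × Plane) × (Plane × Plane) => q.2.2 :=
    measurable_snd.comp measurable_snd
  unfold gainCycle
  exact (((measurable_normalizedGain h11 h21 d).mul
    (measurable_conj_normalizedGain h11 h22 d)).mul
    (measurable_normalizedGain h12 h22 d)).mul (measurable_conj_normalizedGain h12 h21 d)

theorem norm_normalizedGain {d : ℝ} (hd : 0 ≤ d) (x w : Plane) :
    ‖normalizedGain d x w‖ = d / dist x w := by
  have : (2 * Real.pi * Complex.I * (dist x w : ℝ) : ℂ) =
      ((2 * Real.pi * dist x w : ℝ) : ℂ) * Complex.I := by push_cast; ring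
  rw [normalizedGain, this, norm_mul, Complex.norm_exp_ofReal_mul_I, mul_one, Complex.norm_real,
    Real.norm_eq_abs, abs_of_nonneg (by positivity)]

theorem dist_plane (x w : Plane) : dist x w = hypot (w 0 - x 0) (x 1) (w 1) := by
  rw [EuclideanSpace.dist_eq, Fin.sum_univ_two, Real.dist_eq, Real.dist_eq, sq_abs, sq_abs, hypot]
  congr 1
  ring

section
variable {A d : ℝ} {x w : Plane}

theorem le_dist_of_mem (hx : x ∈ transmitSquare A) (hw : w ∈ receiveSquare A d) :
    d ≤ dist x w := by
  rw [dist_plane]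
  exact le_trans (by linarith [hx.1.2, hw.1.1]) (le_hypot _ _ _)

theorem sq_dist_le_of_mem (hd : 0 ≤ d) (hAd : √A ≤ d) (hx : x ∈ transmitSquare A)
    (hw : w ∈ receiveSquare A d) : dist x w ^ 2 ≤ 10 * d ^ 2 := by
  rw [dist_plane, hypot_sq]
  -- As `√A ≤ d`, the horizontal separation is at most `3 d` and the vertical one at most `d`; hence
  -- `10 = 9 + 1`.
  have h1 : (w 0 - x 0) ^ 2 ≤ (3 * d) ^ 2 :=
    sq_le_sq' (by linarith [hx.1.2, hw.1.1]) (by linarith [hx.1.1, hw.1.2])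
  have h2 : (w 1 - x 1) ^ 2 ≤ d ^ 2 :=
    sq_le_sq' (by linarith [hx.2.2, hw.2.1]) (by linarith [hx.2.1, hw.2.2])
  linarith

theorem norm_normalizedGain_le_one (hd : 0 < d) (hx : x ∈ transmitSquare A)
    (hw : w ∈ receiveSquare A d) : ‖normalizedGain d x w‖ ≤ 1 := by
  have := le_dist_of_mem hx hw
  rw [norm_normalizedGain hd.le]
  exact div_le_one_of_le₀ this dist_nonneg

theorem one_tenth_le_norm_normalizedGain_sq (hd : 0 < d) (hAd : √A ≤ d)
    (hx : x ∈ transmitSquare A) (hw : w ∈ receiveSquare A d) :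
    1 / 10 ≤ ‖normalizedGain d x w‖ ^ 2 := by
  have h1 := le_dist_of_mem hx hw
  have h2 := sq_dist_le_of_mem hd.le hAd hx hw
  have : 0 < dist x w := hd.trans_le h1
  rw [norm_normalizedGain hd.le, div_pow, div_le_div_iff₀ (by norm_num) (by positivity)]
  linarith

theorem norm_gainCycle_le_one {q : (Plane × Plane) × (Plane × Plane)} (hd : 0 < d)
    (h1 : q.1.1 ∈ transmitSquare A) (h2 : q.1.2 ∈ transmitSquare A)
    (h3 : q.2.1 ∈ receiveSquare A d) (h4 : q.2.2 ∈ receiveSquare A d) :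
    ‖gainCycle d q‖ ≤ 1 := by
  rw [gainCycle, norm_mul, norm_mul, norm_mul, RCLike.norm_conj, RCLike.norm_conj]
  have a := norm_normalizedGain_le_one hd h1 h3
  have b := norm_normalizedGain_le_one hd h1 h4
  have c := norm_normalizedGain_le_one hd h2 h4
  have e := norm_normalizedGain_le_one hd h2 h3
  exact mul_le_one₀ (mul_le_one₀ (mul_le_one₀ a (norm_nonneg _) b) (norm_nonneg _) c)
    (norm_nonneg _) e

end

/-! ### Laws of the node positions. -/

theorem transmit_law (A : ℝ) : uniformOn (transmitSquare A) =
    ((uniformIcc (-√A) 0).prod (uniformIcc 0 (√A))).map planeEquiv :=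
  uniformOn_box _ _ _ _

theorem receive_law (A d : ℝ) : uniformOn (receiveSquare A d) =
    ((uniformIcc d (d + √A)).prod (uniformIcc 0 (√A))).map planeEquiv :=
  uniformOn_box _ _ _ _

theorem isProbabilityMeasure_box {a b c e : ℝ} (hab : a < b) (hce : c < e) :
    IsProbabilityMeasure (((uniformIcc a b).prod (uniformIcc c e)).map planeEquiv) := by
  have := isProbabilityMeasure_uniformIcc hab
  have := isProbabilityMeasure_uniformIcc hce
  exact Measure.isProbabilityMeasure_map planeEquiv.measurable.aemeasurable

theorem isProbabilityMeasure_transmit {A : ℝ} (hA : 0 < A) :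
    IsProbabilityMeasure (uniformOn (transmitSquare A)) := by
  have := Real.sqrt_pos.2 hA
  rw [transmit_law]
  exact isProbabilityMeasure_box (by linarith) this

theorem isProbabilityMeasure_receive {A : ℝ} (hA : 0 < A) (d : ℝ) :
    IsProbabilityMeasure (uniformOn (receiveSquare A d)) := by
  have := Real.sqrt_pos.2 hA
  rw [receive_law]
  exact isProbabilityMeasure_box (by linarith) this

theorem measurableSet_transmitSquare (A : ℝ) : MeasurableSet (transmitSquare A) := by
  have h0 : Measurable fun p : Plane => p 0 := by fun_prop
  have h1 : Measurable fun p : Plane => p 1 := by fun_prop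
  exact (h0 measurableSet_Icc).inter (h1 measurableSet_Icc)

theorem measurableSet_receiveSquare (A d : ℝ) : MeasurableSet (receiveSquare A d) := by
  have h0 : Measurable fun p : Plane => p 0 := by fun_prop
  have h1 : Measurable fun p : Plane => p 1 := by fun_prop
  exact (h0 measurableSet_Icc).inter (h1 measurableSet_Icc)

theorem ae_transmit (A : ℝ) : ∀ᵐ x ∂uniformOn (transmitSquare A), x ∈ transmitSquare A :=
  ProbabilityTheory.ae_cond_mem (measurableSet_transmitSquare A)

theorem ae_receive (A d : ℝ) : ∀ᵐ x ∂uniformOn (receiveSquare A d), x ∈ receiveSquare A d :=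
  ProbabilityTheory.ae_cond_mem (measurableSet_receiveSquare A d)

theorem ae_prod_mem {α β : Type*} [MeasurableSpace α] [MeasurableSpace β] {μ : Measure α}
    {ν : Measure β} [SFinite μ] [SFinite ν] {p : α → Prop} {q : β → Prop}
    (hp : ∀ᵐ x ∂μ, p x) (hq : ∀ᵐ y ∂ν, q y) : ∀ᵐ z ∂μ.prod ν, p z.1 ∧ q z.2 :=
  (Measure.quasiMeasurePreserving_fst.ae hp).and (Measure.quasiMeasurePreserving_snd.ae hq)

theorem ae_fourNodeLaw {A : ℝ} (hA : 0 < A) (d : ℝ) : ∀ᵐ q ∂fourNodeLaw A d,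
    (q.1.1 ∈ transmitSquare A ∧ q.1.2 ∈ transmitSquare A) ∧
      q.2.1 ∈ receiveSquare A d ∧ q.2.2 ∈ receiveSquare A d := by
  have := isProbabilityMeasure_transmit hA
  have := isProbabilityMeasure_receive hA d
  exact ae_prod_mem (ae_prod_mem (ae_transmit A) (ae_transmit A))
    (ae_prod_mem (ae_receive A d) (ae_receive A d))

theorem isProbabilityMeasure_fourNodeLaw {A : ℝ} (hA : 0 < A) (d : ℝ) :
    IsProbabilityMeasure (fourNodeLaw A d) := by
  have := isProbabilityMeasure_transmit hA
  have := isProbabilityMeasure_receive hA d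
  unfold fourNodeLaw
  infer_instance

theorem integrable_gainCycle {A d : ℝ} (hA : 0 < A) (hd : 0 < d) :
    Integrable (gainCycle d) (fourNodeLaw A d) := by
  have := isProbabilityMeasure_fourNodeLaw hA d
  refine Integrable.of_bound (measurable_gainCycle d).aestronglyMeasurable 1 ?_
  filter_upwards [ae_fourNodeLaw hA d] with q hq
  exact norm_gainCycle_le_one hd hq.1.1 hq.1.2 hq.2.1 hq.2.2

/-! ### The bound on the four-node correlation. -/

/-- The interference at a receiver `w` of the gains from the transmitters `p.1` and `p.2`. -/
def interference (d : ℝ) (p : Plane × Plane) (w : Plane) : ℂ :=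
  normalizedGain d p.1 w * starRingEnd ℂ (normalizedGain d p.2 w)

/-- For fixed transmitters the product separates into one function at `w_a` and its conjugate at
`w_b`, so its mean over the receivers is a squared modulus. -/
theorem gainCycle_eq (d : ℝ) (q : (Plane × Plane) × (Plane × Plane)) :
    gainCycle d q = interference d q.1 q.2.1 * starRingEnd ℂ (interference d q.1 q.2.2) := by
  simp only [gainCycle, interference, map_mul, Complex.conj_conj]
  ring

theorem measurable_interference {α : Type*} [MeasurableSpace α] {f : α → Plane × Plane}
    {g : α → Plane} (hf : Measurable f) (hg : Measurable g) (d : ℝ) :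
    Measurable fun a => interference d (f a) (g a) := by
  unfold interference
  exact (measurable_normalizedGain hf.fst hg d).mul (measurable_conj_normalizedGain hf.snd hg d)

theorem norm_interference_le_one {A d : ℝ} {p : Plane × Plane} {w : Plane} (hd : 0 < d)
    (h1 : p.1 ∈ transmitSquare A) (h2 : p.2 ∈ transmitSquare A) (hw : w ∈ receiveSquare A d) :
    ‖interference d p w‖ ≤ 1 := by
  rw [interference, norm_mul, RCLike.norm_conj]
  exact mul_le_one₀ (norm_normalizedGain_le_one hd h1 hw) (norm_nonneg _)
    (norm_normalizedGain_le_one hd h2 hw)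

theorem interference_planeEquiv (d : ℝ) (p : Plane × Plane) (s t : ℝ) :
    interference d p (planeEquiv (s, t)) =
      ((d ^ 2 : ℝ) : ℂ) * fringe (s - p.1 0) (s - p.2 0) (p.1 1) (p.2 1) t := by
  simp only [interference, normalizedGain, dist_plane, planeEquiv_zero, planeEquiv_one, fringe]
  generalize hypot (s - p.1 0) (p.1 1) t = ra
  generalize hypot (s - p.2 0) (p.2 1) t = rb
  have hc : (starRingEnd ℂ) (2 * Real.pi * Complex.I * (rb : ℂ)) =
      -(2 * Real.pi * Complex.I * rb) := by
    simp only [map_mul, Complex.conj_I, Complex.conj_ofReal, map_ofNat]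
    ring
  rw [map_mul, Complex.conj_ofReal, ← Complex.exp_conj, hc, mul_mul_mul_comm, ← Complex.exp_add,
    ← mul_assoc, ← Complex.ofReal_mul, ← Complex.ofReal_mul]
  congr 2
  · rw [div_mul_div_comm]; ring_nf
  · push_cast; ring

/-- The average interference over the receivers with horizontal coordinate `s`. -/
def columnInterference (d D : ℝ) (p : Plane × Plane) (s : ℝ) : ℂ :=
  ∫ t, interference d p (planeEquiv (s, t)) ∂uniformIcc 0 D

theorem columnInterference_eq {D : ℝ} (hD : 0 < D) (d : ℝ) (p : Plane × Plane) (s : ℝ) :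
    columnInterference d D p s = ((d ^ 2 / D : ℝ) : ℂ) *
      ∫ t in (0 : ℝ)..D, fringe (s - p.1 0) (s - p.2 0) (p.1 1) (p.2 1) t := by
  simp only [columnInterference, interference_planeEquiv]
  rw [integral_const_mul, uniformIcc_eq, integral_smul_measure, integral_Icc_eq_integral_Ioc,
    ← intervalIntegral.integral_of_le hD.le, sub_zero, ENNReal.toReal_inv,
    ENNReal.toReal_ofReal hD.le, Complex.real_smul, ← mul_assoc, ← Complex.ofReal_mul,
    div_eq_mul_inv]

theorem measurable_columnInterference (d D : ℝ) :
    Measurable fun z : (Plane × Plane) × ℝ => columnInterference d D z.1 z.2 := by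
  have h1 : Measurable fun y : ((Plane × Plane) × ℝ) × ℝ => y.1.1 :=
    measurable_fst.comp measurable_fst
  have h2 : Measurable fun y : ((Plane × Plane) × ℝ) × ℝ => y.1.2 :=
    measurable_snd.comp measurable_fst
  have h3 : Measurable fun y : ((Plane × Plane) × ℝ) × ℝ => planeEquiv (y.1.2, y.2) :=
    planeEquiv.measurable.comp (h2.prodMk measurable_snd)
  have h := (measurable_interference h1 h3 d).stronglyMeasurable
  exact (StronglyMeasurable.integral_prod_right' (ν := uniformIcc 0 D) h).measurable

theorem measurable_sq_enorm_columnInterference {α : Type*} [MeasurableSpace α]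
    {f : α → Plane × Plane} {g : α → ℝ} (hf : Measurable f) (hg : Measurable g) (d D : ℝ) :
    Measurable fun a => ‖columnInterference d D (f a) (g a)‖ₑ ^ 2 :=
  ((measurable_columnInterference d D).comp (hf.prodMk hg)).enorm.pow_const 2

/-- Jensen's inequality, as the comparison of the first and second norms on a probability space. -/
theorem sq_enorm_integral_le {α : Type*} [MeasurableSpace α] {μ : Measure α}
    [IsProbabilityMeasure μ] {f : α → ℂ} (hf : AEStronglyMeasurable f μ) :
    ‖∫ a, f a ∂μ‖ₑ ^ 2 ≤ ∫⁻ a, ‖f a‖ₑ ^ 2 ∂μ := by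
  have h1 : ‖∫ a, f a ∂μ‖ₑ ≤ eLpNorm f 2 μ := by
    refine (enorm_integral_le_lintegral_enorm f).trans ?_
    rw [← eLpNorm_one_eq_lintegral_enorm]
    exact eLpNorm_le_eLpNorm_of_exponent_le (by norm_num) hf
  have h2 := eLpNorm_nnreal_pow_eq_lintegral (f := f) (μ := μ) (p := 2) (by norm_num)
  calc ‖∫ a, f a ∂μ‖ₑ ^ 2 ≤ eLpNorm f 2 μ ^ 2 := by gcongr
    _ = _ := by simpa using h2

theorem integral_interference_eq {A d : ℝ} (hA : 0 < A) (hd : 0 < d) {p : Plane × Plane}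
    (h1 : p.1 ∈ transmitSquare A) (h2 : p.2 ∈ transmitSquare A) :
    ∫ w, interference d p w ∂uniformOn (receiveSquare A d) =
      ∫ s, columnInterference d (√A) p s ∂uniformIcc d (d + √A) := by
  have hD := Real.sqrt_pos.2 hA
  have := isProbabilityMeasure_receive hA d
  have hint : Integrable (interference d p) (uniformOn (receiveSquare A d)) := by
    refine Integrable.of_bound
      (measurable_interference measurable_const measurable_id d).aestronglyMeasurable 1 ?_
    filter_upwards [ae_receive A d] with w hw
    exact norm_interference_le_one hd h1 h2 hw
  rw [receive_law] at hint ⊢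
  rw [integral_map_equiv]
  rw [planeEquiv.measurableEmbedding.integrable_map_iff] at hint
  exact integral_prod _ hint

/-- The integrals are reordered so that the height of `x_a` is innermost, everything else being
fixed; `lintegral_average_fringe_le` is uniform in the rest. -/
theorem lintegral_columnInterference_le {A d : ℝ} (hA : 0 < A) (hAd : √A ≤ d) :
    ∫⁻ p, ∫⁻ s, ‖columnInterference d (√A) p s‖ₑ ^ 2 ∂uniformIcc d (d + √A)
      ∂((uniformOn (transmitSquare A)).prod (uniformOn (transmitSquare A))) ≤
    ENNReal.ofReal (200 * (d / A)) := by
  have hD := Real.sqrt_pos.2 hA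
  have hd := hD.trans_le hAd
  have hT := isProbabilityMeasure_transmit hA
  have := isProbabilityMeasure_uniformIcc (show d < d + √A by linarith)
  have := isProbabilityMeasure_uniformIcc (show -√A < 0 by linarith)
  have := isProbabilityMeasure_uniformIcc hD
  have hm : Measurable fun z : (Plane × Plane) × ℝ =>
      ‖columnInterference d (√A) z.1 z.2‖ₑ ^ 2 :=
    measurable_sq_enorm_columnInterference measurable_fst measurable_snd d (√A)
  have key : ∀ xb ∈ transmitSquare A, ∀ s ∈ Set.Icc d (d + √A),
      ∫⁻ xa, ‖columnInterference d (√A) (xa, xb) s‖ₑ ^ 2 ∂uniformOn (transmitSquare A) ≤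
        ENNReal.ofReal (200 * (d / A)) := by
    intro xb hxb s hs
    have hm2 : Measurable fun z : ℝ × ℝ =>
        ‖columnInterference d (√A) (planeEquiv z, xb) s‖ₑ ^ 2 :=
      measurable_sq_enorm_columnInterference (planeEquiv.measurable.prodMk measurable_const)
        measurable_const d (√A)
    rw [transmit_law, lintegral_map_equiv, lintegral_prod _ hm2.aemeasurable]
    refine (lintegral_mono_ae (g := fun _ => ENNReal.ofReal (200 * (d / A))) ?_).trans (by simp)
    filter_upwards [ae_uniformIcc (-√A) 0] with u hu
    have := lintegral_average_fringe_le (qa := s - u) (qb := s - xb 0) (vb := xb 1) hd hD hAd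
      (by linarith [hs.1, hu.2]) (by linarith [hs.1, hxb.1.2]) hxb.2
    rw [Real.sq_sqrt hA.le] at this
    simpa only [columnInterference_eq hD, planeEquiv_zero, planeEquiv_one] using this
  have hm2 : Measurable fun p : Plane × Plane =>
      ∫⁻ s, ‖columnInterference d (√A) p s‖ₑ ^ 2 ∂uniformIcc d (d + √A) :=
    Measurable.lintegral_prod_right' hm
  rw [lintegral_prod_symm _ hm2.aemeasurable]
  refine (lintegral_mono_ae (g := fun _ => ENNReal.ofReal (200 * (d / A))) ?_).trans (by simp)
  filter_upwards [ae_transmit A] with xb hxb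
  have hm3 : Measurable (Function.uncurry fun (xa : Plane) (s : ℝ) =>
      ‖columnInterference d (√A) (xa, xb) s‖ₑ ^ 2) :=
    measurable_sq_enorm_columnInterference (measurable_fst.prodMk measurable_const)
      measurable_snd d (√A)
  rw [lintegral_lintegral_swap (f := fun xa s => ‖columnInterference d (√A) (xa, xb) s‖ₑ ^ 2)
    hm3.aemeasurable]
  refine (lintegral_mono_ae (g := fun _ => ENNReal.ofReal (200 * (d / A))) ?_).trans (by simp)
  filter_upwards [ae_uniformIcc d (d + √A)] with s hs
  exact key xb hxb s hs

theorem norm_integral_gainCycle_le {A d : ℝ} (hA : 0 < A) (hAd : √A ≤ d) :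
    ‖∫ q, gainCycle d q ∂fourNodeLaw A d‖ ≤ 200 * (d / A) := by
  have hD := Real.sqrt_pos.2 hA
  have hd := hD.trans_le hAd
  have hT := isProbabilityMeasure_transmit hA
  have hR := isProbabilityMeasure_receive hA d
  have := isProbabilityMeasure_uniformIcc (show d < d + √A by linarith)
  have hint := integrable_gainCycle hA hd
  have hbound : 0 ≤ 200 * (d / A) := by positivity
  rw [← ENNReal.ofReal_le_ofReal_iff hbound, ofReal_norm]
  rw [fourNodeLaw] at hint ⊢
  rw [integral_prod _ hint]
  refine (enorm_integral_le_lintegral_enorm _).trans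
    (le_trans (lintegral_mono_ae ?_) (lintegral_columnInterference_le hA hAd))
  filter_upwards [ae_prod_mem (ae_transmit A) (ae_transmit A)] with p hp
  simp only [gainCycle_eq]
  rw [integral_prod_mul (interference d p) (fun w => starRingEnd ℂ (interference d p w)),
    integral_conj, enorm_mul, RCLike.enorm_conj, ← sq, integral_interference_eq hA hd hp.1 hp.2]
  exact sq_enorm_integral_le
    ((measurable_columnInterference d (√A)).comp measurable_prodMk_left).aestronglyMeasurable

/-! ### Capacity bounds from the first two traces. -/

theorem Matrix.PosSemidef.exists_spectrum {n : Type*} [Fintype n] [DecidableEq n]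
    {X : Matrix n n ℂ} (hX : X.PosSemidef) :
    ∃ ev : n → ℝ, (∀ i, 0 ≤ ev i) ∧ (Matrix.det (1 + X)).re = ∏ i, (1 + ev i) ∧
      X.trace.re = ∑ i, ev i ∧ (X * X).trace.re = ∑ i, ev i ^ 2 := by
  set D : Matrix n n ℂ := Matrix.diagonal (RCLike.ofReal ∘ hX.1.eigenvalues) with hD
  set φ := Unitary.conjStarAlgAut ℂ (Matrix n n ℂ) hX.1.eigenvectorUnitary with hφ
  have hspec : X = φ D := hX.1.spectral_theorem
  have hU : star (hX.1.eigenvectorUnitary : Matrix n n ℂ) * hX.1.eigenvectorUnitary = 1 :=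
    Unitary.coe_star_mul_self _
  have hdet : ∀ Y, (φ Y).det = Y.det := by
    intro Y
    rw [hφ, Unitary.conjStarAlgAut_apply, Matrix.det_mul_comm, ← mul_assoc, hU, one_mul]
  have htr : ∀ Y, (φ Y).trace = Y.trace := by
    intro Y
    rw [hφ, Unitary.conjStarAlgAut_apply, Matrix.trace_mul_comm, ← mul_assoc, hU, one_mul]
  refine ⟨hX.1.eigenvalues, hX.eigenvalues_nonneg, ?_, ?_, ?_⟩
  · have : 1 + X = φ (1 + D) := by rw [map_add, map_one, ← hspec]
    rw [this, hdet, hD, ← Matrix.diagonal_one, Matrix.diagonal_add, Matrix.det_diagonal]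
    have : ∏ i, (1 + (RCLike.ofReal ∘ hX.1.eigenvalues) i : ℂ) =
        ((∏ i, (1 + hX.1.eigenvalues i) : ℝ) : ℂ) := by
      push_cast; rfl
    rw [this, Complex.ofReal_re]
  · rw [hX.1.trace_eq_sum_eigenvalues]
    simp
  · have : X * X = φ (D * D) := by rw [map_mul, ← hspec]
    rw [this, htr, hD, Matrix.diagonal_mul_diagonal, Matrix.trace_diagonal]
    simp [sq]

/-- With `z = ε y`, `log (1 + y) ≥ log (1 + z) ≥ z / (1 + z) ≥ z - z²`. The free `ε` lets the linear
term dominate after taking expectations. -/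
theorem sub_sq_le_log_one_add {ε y : ℝ} (hε : 0 ≤ ε) (hε1 : ε ≤ 1) (hy : 0 ≤ y) :
    ε * y - ε ^ 2 * y ^ 2 ≤ Real.log (1 + y) := by
  have hz : 0 ≤ ε * y := mul_nonneg hε hy
  have h1 : Real.log (1 + ε * y) ≤ Real.log (1 + y) :=
    Real.log_le_log (by linarith) (by nlinarith)
  have h2 := Real.one_sub_inv_le_log_of_pos (show 0 < 1 + ε * y by linarith)
  have h3 : ε * y - ε ^ 2 * y ^ 2 ≤ 1 - (1 + ε * y)⁻¹ := by
    rw [show 1 - (1 + ε * y)⁻¹ = ε * y / (1 + ε * y) by field_simp; ring,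
      le_div_iff₀ (by linarith)]
    nlinarith [pow_nonneg hz 3]
  linarith

section capacity
variable {M : ℕ} {s : ℝ} (hs : 0 ≤ s) (H : Matrix (Fin M) (Fin M) ℂ)

theorem trace_mul_conjTranspose (H : Matrix (Fin M) (Fin M) ℂ) :
    (H * H.conjTranspose).trace.re = ∑ i, ∑ k, ‖H i k‖ ^ 2 := by
  simp only [Matrix.trace, Matrix.diag_apply, Matrix.mul_apply, Matrix.conjTranspose_apply,
    Complex.re_sum]
  refine Finset.sum_congr rfl fun i _ => Finset.sum_congr rfl fun k _ => ?_
  rw [← starRingEnd_apply, Complex.mul_conj, Complex.ofReal_re, Complex.normSq_eq_norm_sq]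

theorem trace_sq_mul_conjTranspose (H : Matrix (Fin M) (Fin M) ℂ) :
    (H * H.conjTranspose * (H * H.conjTranspose)).trace =
      ∑ i, ∑ l, ∑ k, ∑ m, H i k * starRingEnd ℂ (H l k) * H l m * starRingEnd ℂ (H i m) := by
  simp only [Matrix.trace, Matrix.diag_apply, Matrix.mul_apply, Matrix.conjTranspose_apply,
    Finset.sum_mul_sum]
  simp only [← starRingEnd_apply, ← mul_assoc]

include hs in
theorem posSemidef_smul_mul_conjTranspose :
    (((s / M : ℝ) : ℂ) • (H * H.conjTranspose)).PosSemidef := by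
  refine (Matrix.posSemidef_self_mul_conjTranspose H).smul ?_
  exact Complex.zero_le_real.2 (by positivity)

include hs in
theorem mimoCapacity_nonneg : 0 ≤ mimoCapacity s H := by
  obtain ⟨ev, h0, hdet, -, -⟩ := (posSemidef_smul_mul_conjTranspose hs H).exists_spectrum
  rw [mimoCapacity, hdet, Real.log_prod fun i _ => by linarith [h0 i]]
  exact Finset.sum_nonneg fun i _ => Real.log_nonneg (by linarith [h0 i])

include hs in
theorem mimoCapacity_le :
    mimoCapacity s H ≤ s / M * ∑ i, ∑ k, ‖H i k‖ ^ 2 := by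
  obtain ⟨ev, h0, hdet, htr, -⟩ := (posSemidef_smul_mul_conjTranspose hs H).exists_spectrum
  rw [mimoCapacity, hdet, Real.log_prod fun i _ => by linarith [h0 i]]
  rw [Matrix.trace_smul, smul_eq_mul, Complex.re_ofReal_mul, trace_mul_conjTranspose] at htr
  rw [htr]
  refine Finset.sum_le_sum fun i _ => ?_
  have := Real.log_le_sub_one_of_pos (show 0 < 1 + ev i by linarith [h0 i])
  linarith

include hs in
theorem le_mimoCapacity {ε : ℝ} (hε : 0 ≤ ε) (hε1 : ε ≤ 1) :
    ε * (s / M * ∑ i, ∑ k, ‖H i k‖ ^ 2) - ε ^ 2 * ((s / M) ^ 2 *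
      ∑ i, ∑ l, ∑ k, ∑ m,
        (H i k * starRingEnd ℂ (H l k) * H l m * starRingEnd ℂ (H i m)).re) ≤
      mimoCapacity s H := by
  obtain ⟨ev, h0, hdet, htr, htr2⟩ := (posSemidef_smul_mul_conjTranspose hs H).exists_spectrum
  rw [mimoCapacity, hdet, Real.log_prod fun i _ => by linarith [h0 i]]
  rw [Matrix.trace_smul, smul_eq_mul, Complex.re_ofReal_mul, trace_mul_conjTranspose] at htr
  rw [Matrix.smul_mul, Matrix.mul_smul, smul_smul, Matrix.trace_smul, smul_eq_mul,
    ← Complex.ofReal_mul, Complex.re_ofReal_mul, trace_sq_mul_conjTranspose, ← sq] at htr2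
  simp only [Complex.re_sum] at htr2
  rw [htr, htr2, Finset.mul_sum, Finset.mul_sum, ← Finset.sum_sub_distrib]
  exact Finset.sum_le_sum fun i _ => sub_sq_le_log_one_add hε hε1 (h0 i)

end capacity

/-! ### Measurability of the capacity and reduction to normalized gains. -/

theorem measurable_det {α n : Type*} [MeasurableSpace α] [Fintype n] [DecidableEq n]
    {X : α → Matrix n n ℂ} (hX : ∀ i j, Measurable fun a => X a i j) :
    Measurable fun a => (X a).det := by
  simp only [Matrix.det_apply']
  exact Finset.measurable_fun_sum _ fun σ _ =>
    (Finset.measurable_fun_prod _ fun i _ => hX _ _).const_mul _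

theorem measurable_mimoCapacity {α : Type*} [MeasurableSpace α] {M : ℕ}
    {H : α → Matrix (Fin M) (Fin M) ℂ} (hH : ∀ i j, Measurable fun a => H a i j) (s : ℝ) :
    Measurable fun a => mimoCapacity s (H a) := by
  unfold mimoCapacity
  refine Real.measurable_log.comp (Complex.measurable_re.comp (measurable_det fun i j => ?_))
  simp only [Matrix.add_apply, Matrix.smul_apply, Matrix.mul_apply, Matrix.conjTranspose_apply,
    smul_eq_mul]
  refine measurable_const.add (Measurable.const_mul ?_ _)
  exact Finset.measurable_fun_sum _ fun k _ => 
    (hH i k).mul (Complex.continuous_conj.measurable.comp (hH j k))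

/-- The matrix of normalized gains. -/
def gainMatrix {M : ℕ} (d : ℝ) (x w : Fin M → Plane) : Matrix (Fin M) (Fin M) ℂ :=
  Matrix.of fun i k => normalizedGain d (x k) (w i)

theorem channel_eq {M : ℕ} (G : ℝ) {d : ℝ} (hd : d ≠ 0) (x w : Fin M → Plane) :
    channel G x w = ((√G / d : ℝ) : ℂ) • gainMatrix d x w := by
  ext i k
  simp only [channel, gainMatrix, normalizedGain, Matrix.of_apply, Matrix.smul_apply, smul_eq_mul]
  push_cast
  have : (d : ℂ) ≠ 0 := Complex.ofReal_ne_zero.2 hd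
  field_simp

/-- The factor `G / d²` moves into the power ratio, which becomes exactly the quantity assumed to
exceed `1`. -/
theorem mimoCapacity_channel {M : ℕ} {G : ℝ} (hG : 0 ≤ G) {d : ℝ} (hd : d ≠ 0) (s : ℝ)
    (x w : Fin M → Plane) :
    mimoCapacity s (channel G x w) = mimoCapacity (s * G / d ^ 2) (gainMatrix d x w) := by
  rw [mimoCapacity, mimoCapacity, channel_eq G hd, Matrix.conjTranspose_smul, Matrix.smul_mul,
    Matrix.mul_smul, smul_smul, smul_smul, ← starRingEnd_apply, Complex.conj_ofReal,
    ← Complex.ofReal_mul, ← Complex.ofReal_mul]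
  congr 6
  linear_combination (s / (M * d ^ 2)) * Real.sq_sqrt hG

theorem gainMatrix_cycle {M : ℕ} (d : ℝ) (x w : Fin M → Plane) (i l k m : Fin M) :
    gainMatrix d x w i k * starRingEnd ℂ (gainMatrix d x w l k) * gainMatrix d x w l m *
      starRingEnd ℂ (gainMatrix d x w i m) = gainCycle d ((x k, x m), (w i, w l)) := rfl

/-! ### From `M` node pairs to four nodes. -/

theorem measurePreserving_eval_pair {ι α : Type*} [Fintype ι] [MeasurableSpace α] (μ : Measure α)
    [IsProbabilityMeasure μ] {k m : ι} (h : k ≠ m) :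
    MeasurePreserving (fun x : ι → α => (x k, x m)) (Measure.pi fun _ => μ) (μ.prod μ) := by
  have hind := ProbabilityTheory.iIndepFun_pi (μ := fun _ : ι => μ) (X := fun _ a => a)
    fun _ => aemeasurable_id
  have hpair := (ProbabilityTheory.indepFun_iff_map_prod_eq_prod_map_map
    (measurable_pi_apply k).aemeasurable (measurable_pi_apply m).aemeasurable).1 (hind.indepFun h)
  refine ⟨(measurable_pi_apply k).prodMk (measurable_pi_apply m), hpair.trans ?_⟩
  rw [(measurePreserving_eval (fun _ : ι => μ) k).map_eq,
    (measurePreserving_eval (fun _ : ι => μ) m).map_eq]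

theorem measurePreserving_fourNode {A : ℝ} (hA : 0 < A) (d : ℝ) {M : ℕ} {i l k m : Fin M}
    (hil : i ≠ l) (hkm : k ≠ m) :
    MeasurePreserving (fun p : (Fin M → Plane) × (Fin M → Plane) =>
      ((p.1 k, p.1 m), (p.2 i, p.2 l))) (nodeLaw M A d) (fourNodeLaw A d) := by
  have := isProbabilityMeasure_transmit hA
  have := isProbabilityMeasure_receive hA d
  exact (measurePreserving_eval_pair _ hkm).prod (measurePreserving_eval_pair _ hil)

theorem isProbabilityMeasure_nodeLaw {A : ℝ} (hA : 0 < A) (d : ℝ) (M : ℕ) :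
    IsProbabilityMeasure (nodeLaw M A d) := by
  have := isProbabilityMeasure_transmit hA
  have := isProbabilityMeasure_receive hA d
  unfold nodeLaw
  infer_instance

theorem ae_pi_mem {ι α : Type*} [Fintype ι] [MeasurableSpace α] {μ : Measure α}
    [IsProbabilityMeasure μ] {p : α → Prop} (h : ∀ᵐ a ∂μ, p a) :
    ∀ᵐ x ∂(Measure.pi fun _ : ι => μ), ∀ i, p (x i) :=
  ae_all_iff.2 fun i => (measurePreserving_eval (fun _ : ι => μ) i).quasiMeasurePreserving.ae h

theorem ae_nodeLaw {A : ℝ} (hA : 0 < A) (d : ℝ) (M : ℕ) : ∀ᵐ p ∂nodeLaw M A d,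
    (∀ k, p.1 k ∈ transmitSquare A) ∧ ∀ i, p.2 i ∈ receiveSquare A d := by
  have := isProbabilityMeasure_transmit hA
  have := isProbabilityMeasure_receive hA d
  exact ae_prod_mem (ae_pi_mem (ae_transmit A)) (ae_pi_mem (ae_receive A d))

/-! ### The expected capacity. -/

section law
variable {A d : ℝ} (hA : 0 < A) (hAd : √A ≤ d) (M : ℕ)
include hA hAd

theorem integrable_mimoCapacity_gainMatrix {s : ℝ} (hs : 0 ≤ s) :
    Integrable (fun p => mimoCapacity s (gainMatrix d p.1 p.2)) (nodeLaw M A d) := by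
  have hd := (Real.sqrt_pos.2 hA).trans_le hAd
  have := isProbabilityMeasure_nodeLaw hA d M
  have hm : Measurable fun p : (Fin M → Plane) × (Fin M → Plane) =>
      mimoCapacity s (gainMatrix d p.1 p.2) :=
    measurable_mimoCapacity (fun i k => measurable_normalizedGain
      ((measurable_pi_apply k).comp measurable_fst)
      ((measurable_pi_apply i).comp measurable_snd) d) s
  refine Integrable.of_bound hm.aestronglyMeasurable (s / M * ∑ _i : Fin M, ∑ _k : Fin M, 1) ?_
  filter_upwards [ae_nodeLaw hA d M] with p hp
  rw [Real.norm_eq_abs, abs_of_nonneg (mimoCapacity_nonneg hs _)]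
  refine (mimoCapacity_le hs _).trans ?_
  refine mul_le_mul_of_nonneg_left ?_ (by positivity)
  exact Finset.sum_le_sum fun i _ => Finset.sum_le_sum fun k _ =>
    pow_le_one₀ (norm_nonneg _) (norm_normalizedGain_le_one hd (hp.1 k) (hp.2 i))

theorem integrable_gainCycle_nodes (i l k m : Fin M) :
    Integrable (fun p : (Fin M → Plane) × (Fin M → Plane) =>
      (gainCycle d ((p.1 k, p.1 m), (p.2 i, p.2 l))).re) (nodeLaw M A d) := by
  have hd := (Real.sqrt_pos.2 hA).trans_le hAd
  have := isProbabilityMeasure_nodeLaw hA d M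
  have h1 : Measurable fun p : (Fin M → Plane) × (Fin M → Plane) =>
      ((p.1 k, p.1 m), (p.2 i, p.2 l)) := by fun_prop
  refine Integrable.of_bound
    (Complex.measurable_re.comp ((measurable_gainCycle d).comp h1)).aestronglyMeasurable 1 ?_
  filter_upwards [ae_nodeLaw hA d M] with p hp
  exact (Complex.abs_re_le_norm _).trans
    (norm_gainCycle_le_one hd (hp.1 k) (hp.1 m) (hp.2 i) (hp.2 l))

/-- A repeated index destroys the oscillation, and the trivial bound `1` is used; for distinct
indices the four nodes are independent and the correlation bound applies. -/
theorem integral_gainCycle_nodes_le (i l k m : Fin M) :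
    ∫ p, (gainCycle d ((p.1 k, p.1 m), (p.2 i, p.2 l))).re ∂nodeLaw M A d ≤
      (if i = l then 1 else 0) + (if k = m then 1 else 0) + 200 * (d / A) := by
  have hd := (Real.sqrt_pos.2 hA).trans_le hAd
  have := isProbabilityMeasure_nodeLaw hA d M
  have hB : 0 ≤ 200 * (d / A) := by positivity
  have hone : ∫ p, (gainCycle d ((p.1 k, p.1 m), (p.2 i, p.2 l))).re ∂nodeLaw M A d ≤ 1 := by
    calc _ ≤ ∫ _p, (1 : ℝ) ∂nodeLaw M A d := by
          refine integral_mono_ae (integrable_gainCycle_nodes hA hAd M i l k m)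
            (integrable_const _) ?_
          filter_upwards [ae_nodeLaw hA d M] with p hp
          exact (Complex.re_le_norm _).trans
            (norm_gainCycle_le_one hd (hp.1 k) (hp.1 m) (hp.2 i) (hp.2 l))
      _ = 1 := by simp
  by_cases hil : i = l
  · rw [if_pos hil]
    split_ifs
    all_goals linarith
  by_cases hkm : k = m
  · rw [if_neg hil, if_pos hkm]
    linarith
  rw [if_neg hil, if_neg hkm, zero_add, zero_add]
  have hmp := measurePreserving_fourNode hA d hil hkm
  have hre : ∫ q, (gainCycle d q).re ∂fourNodeLaw A d = (∫ q, gainCycle d q ∂fourNodeLaw A d).re :=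
    integral_re (integrable_gainCycle hA hd)
  calc _ = ∫ q, (gainCycle d q).re ∂fourNodeLaw A d := by
        rw [← hmp.map_eq]
        exact (integral_map (f := fun q => (gainCycle d q).re) hmp.measurable.aemeasurable
          (Complex.measurable_re.comp (measurable_gainCycle d)).aestronglyMeasurable).symm
    _ ≤ 200 * (d / A) := by
        rw [hre]
        exact (Complex.re_le_norm _).trans (norm_integral_gainCycle_le hA hAd)

theorem le_integral_mimoCapacity_gainMatrix (hM : 0 < M) {s : ℝ} (hs : 1 ≤ s) :
    M / (800 * (1 + M * (200 * (d / A)))) ≤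
      ∫ p, mimoCapacity s (gainMatrix d p.1 p.2) ∂nodeLaw M A d := by
  have hd := (Real.sqrt_pos.2 hA).trans_le hAd
  have := isProbabilityMeasure_nodeLaw hA d M
  have hM' : (0 : ℝ) < M := Nat.cast_pos.2 hM
  set B := 200 * (d / A) with hB
  have hB0 : 0 ≤ B := by positivity
  have hs0 : 0 < s := by linarith
  -- The parameter `ε` is `e / s`, which cancels `s` from both traces. The factor `40` makes the
  -- quadratic term `e² · 2M (1 + M B)` equal to `e M / 20`, half of the linear term `e M / 10`.
  set e := 1 / (40 * (1 + M * B)) with he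
  have he0 : 0 < e := by positivity
  have he1 : e ≤ 1 := by
    rw [he, div_le_one (by positivity)]
    nlinarith [mul_nonneg hM'.le hB0]
  have hes : e / s ≤ 1 := (div_le_one hs0).2 (he1.trans hs)
  set Q : (Fin M → Plane) × (Fin M → Plane) → ℝ := fun p =>
    ∑ i, ∑ l, ∑ k, ∑ m, (gainCycle d ((p.1 k, p.1 m), (p.2 i, p.2 l))).re with hQ
  have hi := integrable_gainCycle_nodes hA hAd M
  have hQi : Integrable Q (nodeLaw M A d) :=
    integrable_finsetSum _ fun i _ => integrable_finsetSum _ fun l _ =>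
      integrable_finsetSum _ fun k _ => integrable_finsetSum _ fun m _ => hi i l k m
  -- The index sets `i = l` and `k = m` have `M³` quadruples each; `B` is charged to all `M⁴`.
  have hQle : ∫ p, Q p ∂nodeLaw M A d ≤ M ^ 3 + M ^ 3 + M ^ 4 * B := by
    have e1 : ∫ p, Q p ∂nodeLaw M A d = ∑ i, ∑ l, ∑ k, ∑ m,
        ∫ p, (gainCycle d ((p.1 k, p.1 m), (p.2 i, p.2 l))).re ∂nodeLaw M A d := by
      simp only [hQ]
      rw [integral_finsetSum _ fun i _ => integrable_finsetSum _ fun l _ =>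
        integrable_finsetSum _ fun k _ => integrable_finsetSum _ fun m _ => hi i l k m]
      refine Finset.sum_congr rfl fun i _ => ?_
      rw [integral_finsetSum _ fun l _ =>
        integrable_finsetSum _ fun k _ => integrable_finsetSum _ fun m _ => hi i l k m]
      refine Finset.sum_congr rfl fun l _ => ?_
      rw [integral_finsetSum _ fun k _ => integrable_finsetSum _ fun m _ => hi i l k m]
      refine Finset.sum_congr rfl fun k _ => ?_
      rw [integral_finsetSum _ fun m _ => hi i l k m]
    rw [e1]
    calc _ ≤ ∑ i : Fin M, ∑ l : Fin M, ∑ k : Fin M, ∑ m : Fin M,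
          (((if i = l then 1 else 0) + (if k = m then 1 else 0) + B : ℝ)) :=
        Finset.sum_le_sum fun i _ => Finset.sum_le_sum fun l _ => Finset.sum_le_sum fun k _ =>
          Finset.sum_le_sum fun m _ => integral_gainCycle_nodes_le hA hAd M i l k m
      _ = _ := by
        simp only [Finset.sum_add_distrib, Finset.sum_const, Finset.card_univ, Fintype.card_fin,
          nsmul_eq_mul, Finset.sum_ite_eq, Finset.mem_univ, if_true, ← Finset.mul_sum, mul_one]
        ring
  have hbelow : ∀ᵐ p ∂nodeLaw M A d, e * (M / 10) - e ^ 2 * (1 / M ^ 2 * Q p) ≤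
      mimoCapacity s (gainMatrix d p.1 p.2) := by
    filter_upwards [ae_nodeLaw hA d M] with p hp
    refine le_trans ?_ (le_mimoCapacity hs0.le (gainMatrix d p.1 p.2) (by positivity) hes)
    simp only [gainMatrix_cycle]
    have hsum : (M : ℝ) ^ 2 / 10 ≤ ∑ i, ∑ k, ‖gainMatrix d p.1 p.2 i k‖ ^ 2 := by
      calc (M : ℝ) ^ 2 / 10 = ∑ _i : Fin M, ∑ _k : Fin M, (1 / 10 : ℝ) := by
            simp only [Finset.sum_const, Finset.card_univ, Fintype.card_fin, nsmul_eq_mul]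
            ring
        _ ≤ _ := Finset.sum_le_sum fun i _ => Finset.sum_le_sum fun k _ =>
            one_tenth_le_norm_normalizedGain_sq hd hAd (hp.1 k) (hp.2 i)
    have e2 : e / s * (s / M * (M ^ 2 / 10)) = e * (M / 10) := by field_simp
    have e3 : e ^ 2 * (1 / M ^ 2 * Q p) = (e / s) ^ 2 * ((s / M) ^ 2 * Q p) := by field_simp
    rw [← e2, e3]
    gcongr
  have hli : Integrable (fun p => e * (M / 10) - e ^ 2 * (1 / M ^ 2 * Q p)) (nodeLaw M A d) :=
    (integrable_const _).sub ((hQi.const_mul _).const_mul _)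
  refine le_trans ?_ (integral_mono_ae hli
    (integrable_mimoCapacity_gainMatrix hA hAd M hs0.le) hbelow)
  rw [integral_sub (integrable_const _) ((hQi.const_mul _).const_mul _), integral_const,
    probReal_univ, one_smul, integral_const_mul, integral_const_mul]
  have h5 : 1 / (M : ℝ) ^ 2 * ∫ p, Q p ∂nodeLaw M A d ≤ 2 * M * (1 + M * B) := by
    calc _ ≤ 1 / (M : ℝ) ^ 2 * (M ^ 3 + M ^ 3 + M ^ 4 * B) := by gcongr
      _ = 2 * M + M ^ 2 * B := by field_simp; ring
      _ ≤ _ := by nlinarith [mul_nonneg (sq_nonneg (M : ℝ)) hB0]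
  have h6 : e ^ 2 * (1 / (M : ℝ) ^ 2 * ∫ p, Q p ∂nodeLaw M A d) ≤ e * (M / 20) := by
    calc _ ≤ e ^ 2 * (2 * M * (1 + M * B)) := by gcongr
      _ = e * (M / 20) := by
        have : 1 + M * B ≠ 0 := by positivity
        rw [he]; field_simp; norm_num
  have h7 : M / (800 * (1 + M * B)) = e * (M / 20) := by
    have : 1 + M * B ≠ 0 := by positivity
    rw [he]; field_simp; norm_num
  rw [h7]
  linarith

end law

/-! ### Conclusion. -/

theorem min_div_le_div_one_add {m a L : ℝ} (hm : 0 < m) (ha : 0 < a) (hL : 1 ≤ L) :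
    1 / 160800 * min m (a / L) ≤ m / (800 * (1 + m * (200 * a⁻¹))) := by
  have h1 : a / L ≤ a := div_le_self ha.le hL
  have h2 : min m (a / L) ≤ min m a := min_le_min_left _ h1
  have e : m / (800 * (1 + m * (200 * a⁻¹))) = m * a / (800 * (a + 200 * m)) := by
    field_simp
  rw [e, le_div_iff₀ (by positivity)]
  -- `a + 200 m` is at most `201 max m a`, and `min m a * max m a = m a`; this gives `160800 = 800 ·
  -- 201`.
  have h3 : min m a * (a + 200 * m) ≤ 201 * (m * a) := by
    rcases le_total m a with h | h
    · rw [min_eq_left h]; nlinarith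
    · rw [min_eq_right h]; nlinarith
  have h4 := mul_le_mul_of_nonneg_right h2 (show 0 ≤ a + 200 * m by positivity)
  linarith

end

theorem lemma3 :
    (∃ K₃ : ℝ, 0 < K₃ ∧
      ∀ (M : ℕ) (A d G P₀ N₀ W : ℝ), 0 < A → √A ≤ d → d ≤ A →
        0 < G → 0 < N₀ → 0 < W → 1 < G * P₀ / (N₀ * W * d ^ 2) →
        Integrable (fun p => mimoCapacity (P₀ / (N₀ * W)) (channel G p.1 p.2)) (nodeLaw M A d) ∧
        K₃ * min (M : ℝ) ((A / d) / max 1 (Real.log (A / d))) ≤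
          ∫ p, mimoCapacity (P₀ / (N₀ * W)) (channel G p.1 p.2) ∂(nodeLaw M A d)) ∧
    (∃ K : ℝ, 0 < K ∧
      ∀ A d : ℝ, 0 < A → √A ≤ d → d ≤ A →
        Integrable (gainCycle d) (fourNodeLaw A d) ∧
        ‖∫ q, gainCycle d q ∂(fourNodeLaw A d)‖ ≤
          K * ((d / A) * max 1 (Real.log (A / d)))) := by
  refine ⟨⟨1 / 160800, by norm_num, ?_⟩, 200, by norm_num, ?_⟩
  · intro M A d G P₀ N₀ W hA hAd _ hG hN hW hP
    have hd := (Real.sqrt_pos.2 hA).trans_le hAd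
    have hs : P₀ / (N₀ * W) * G / d ^ 2 = G * P₀ / (N₀ * W * d ^ 2) := by
      field_simp
    simp only [mimoCapacity_channel hG.le hd.ne', hs]
    set s := G * P₀ / (N₀ * W * d ^ 2)
    refine ⟨integrable_mimoCapacity_gainMatrix hA hAd M (by linarith), ?_⟩
    -- For `M = 0` the minimum is at most `0`, so nonnegativity of the capacity suffices.
    rcases Nat.eq_zero_or_pos M with rfl | hM
    · refine le_trans ?_ (integral_nonneg fun p => mimoCapacity_nonneg (by linarith) _)
      have : min ((0 : ℕ) : ℝ) ((A / d) / max 1 (Real.log (A / d))) ≤ 0 := by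
        simpa only [Nat.cast_zero] using min_le_left _ _
      linarith
    · refine le_trans ?_ (le_integral_mimoCapacity_gainMatrix hA hAd M hM hP.le)
      have := min_div_le_div_one_add (m := M) (Nat.cast_pos.2 hM) (div_pos hA hd)
        (le_max_left 1 (Real.log (A / d)))
      rwa [inv_div] at this
  · intro A d hA hAd _
    have hd := (Real.sqrt_pos.2 hA).trans_le hAd
    refine ⟨integrable_gainCycle hA hd, (norm_integral_gainCycle_le hA hAd).trans ?_⟩
    have : 0 ≤ d / A := by positivity
    have := le_mul_of_one_le_right this (le_max_left 1 (Real.log (A / d)))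
    linarith
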